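/- **The Penrose limit of a lorentzian metric along a homogeneous null geodesic is a (locally) homogeneous plane wave.** Let $(M,g)$ be a smooth lorentzian manifold of dimension $n+1=m+2\ge 2$ (signature $(-,+,\dots,+)$), let $J\subseteq\mathbb R$ be an open interval and let $\gamma:J\to M$ be an affinely parametrized null geodesic. Suppose $\gamma$ is homogeneous, i.e. up to parametrization it runs along an orbit of a one-parameter group $(\varphi_t)_{t\in\mathbb R}$ of isometries of $(M,g)$: there are $p\in M$ and a smooth function $s:J\to\mathbb R$ with $\gamma(u)=\varphi_{s(u)}(p)$ for all $u\in J$. For an open interval $I\subseteq J$, *coordinates adapted to $\gamma|_I$* are given by a smooth local diffeomorphism $\Phi:U\to M$ from an open set $U\subseteq\mathbb R\times\mathbb R\times\mathbb R^{m}$ (with coordinates $(u,v,y^1,\dots,y^m)$) which contains $I\times\{0\}\times\{0\}$, such that $\Phi(u,0,0)=\gamma(u)$ for $u\in I$ and, on $U$, $$\Phi^*g=du\,dv+\alpha\,dv^2+\sum_i\beta_i\,dy^i\,dv+\sum_{i,j}C_{ij}\,dy^i\,dy^j,$$ where $\alpha,\beta_i,C_{ij}$ are functions of $(u,v,y)$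 and $(C_{ij})$ is symmetric positive definite. Put $\psi_\Omega(u,v,y)=(u,\Omega^2v,\Omega y)$. The *Penrose limit* of $g$ along $\gamma|_I$ in these coordinates is the metric $$g_{Pl}=\lim_{\Omega\to0^+}\Omega^{-2}\,\psi_\Omega^*\,\Phi^*g$$ on the slab $S_I=I\times\mathbb R\times\mathbb R^{m}$ (pointwise limit of the components). 1. For all coordinates adapted to a portion $\gamma|_I$ of $\gamma$, the Penrose limit exists and is the plane wave $g_{Pl}=du\,dv+\sum_{i,j}C_{ij}(u,0,0)\,dy^i\,dy^j$, whose coefficients are smooth on $I$ and positive definite, and: - $(S_I,g_{Pl})$ is locally homogeneous: for any two points $a,b\in S_I$ there is an isometry from an open neighbourhood of $a$ in $S_I$ onto an open neighbourhood of $b$ in $S_I$ which maps $a$ to $b$; - $(S_I,g_{Pl})$ has a smooth Killing vector field $K$ with $K(u,0,0)=f(u)\,\partial_u$ and $f(u)\neq0$ for all $u\in I$; - for every $a\in S_I$, every tangent vector at $a$ is the value at $a$ of a smooth Killing vector field of $(S_I,g_{Pl})$; - if moreover $s(I)=\mathbb R$, i.e. $\gamma|_I$ runs through the whole orbit of the one-parameter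 group, then $(S_I,g_{Pl})$ is homogeneous: its isometries act transitively. 2. Penrose limits of $g$ computed in coordinates adapted to two (possibly different) portions $\gamma|_{I_1}$, $\gamma|_{I_2}$ of $\gamma$ are locally isometric at any two points: for $a\in S_{I_1}$ and $b\in S_{I_2}$ there is an isometry, with respect to the two limit metrics, from an open neighbourhood of $a$ in $S_{I_1}$ onto an open neighbourhood of $b$ in $S_{I_2}$ which maps $a$ to $b$. (So a space patched together from such limits along $\gamma$ is locally homogeneous too.) -/

import Mathlib

open Set Filter Topology Bundle
open scoped Manifold ContDiff

noncomputable section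

namespace PenroseLimit

/-- The coordinate space: a point is `(u, v, y)` with `y = (y¹, …, yᵐ)`. -/
abbrev Coord (m : ℕ) : Type := ℝ × ℝ × (Fin m → ℝ)

section Spacetime

variable {E : Type*} [NormedAddCommGroup E] [NormedSpace ℝ E]
  {M : Type*} [TopologicalSpace M] [ChartedSpace E M] [IsManifold 𝓘(ℝ, E) ∞ M]

variable (E M) in
/-- A smooth lorentzian metric (signature `(-,+,…,+)`) on a manifold `M` modelled on `E`. -/
structure LorentzMetric where
  /-- The scalar product on each tangent space. -/
  inner (x : M) : TangentSpace 𝓘(ℝ, E) x →L[ℝ] TangentSpace 𝓘(ℝ, E) x →L[ℝ] ℝ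
  symm (x : M) (v w : TangentSpace 𝓘(ℝ, E) x) : inner x v w = inner x w v
  lorentzian (x : M) : ∃ t : TangentSpace 𝓘(ℝ, E) x, inner x t t < 0 ∧
    ∀ w : TangentSpace 𝓘(ℝ, E) x, inner x t w = 0 → w ≠ 0 → 0 < inner x w w
  contMDiff : ContMDiff 𝓘(ℝ, E) (𝓘(ℝ, E).prod 𝓘(ℝ, E →L[ℝ] E →L[ℝ] ℝ)) ∞
    (fun x ↦ TotalSpace.mk' (E →L[ℝ] E →L[ℝ] ℝ)
      (E := fun x : M ↦
        (TangentSpace 𝓘(ℝ, E) x →L[ℝ] TangentSpace 𝓘(ℝ, E) x →L[ℝ] ℝ)) x (inner x))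

/-- The pull-back `Φ^* g` of the metric to a vector space `V` under `Φ : V → M`:
`(Φ^* g)_z (X, Y) = g_{Φ z} (dΦ_z X, dΦ_z Y)`. -/
def pullback (g : LorentzMetric E M) {V : Type*} [NormedAddCommGroup V] [NormedSpace ℝ V]
    (Φ : V → M) (z X Y : V) : ℝ :=
  g.inner (Φ z) (mfderiv 𝓘(ℝ, V) 𝓘(ℝ, E) Φ z X) (mfderiv 𝓘(ℝ, V) 𝓘(ℝ, E) Φ z Y)

/-- `Φ : V → M`, defined on a vector space `V`, is a smooth local diffeomorphism at each point
of `U`. -/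
def IsLocalDiffeoOn (E : Type*) [NormedAddCommGroup E] [NormedSpace ℝ E]
    {M : Type*} [TopologicalSpace M] [ChartedSpace E M]
    {V : Type*} [NormedAddCommGroup V] [NormedSpace ℝ V] (Φ : V → M) (U : Set V) : Prop :=
  IsLocalDiffeomorphOn 𝓘(ℝ, V) 𝓘(ℝ, E) ∞ Φ U

/-- Christoffel symbols of the first kind of a metric `G` on a vector space:
`Γ(a, b; c) = (∂_a G(b, c) + ∂_b G(a, c) - ∂_c G(a, b)) / 2`, which is `G(∇_a b, c)` for constant
vector fields `a, b, c`. -/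
def christoffelFirst {V : Type*} [NormedAddCommGroup V] [NormedSpace ℝ V]
    (G : V → V → V → ℝ) (z a b c : V) : ℝ :=
  (fderiv ℝ (fun z' ↦ G z' b c) z a + fderiv ℝ (fun z' ↦ G z' a c) z b
    - fderiv ℝ (fun z' ↦ G z' a b) z c) / 2

variable (E) in
/-- The velocity `γ'(t)`. -/
def velocity (γ : ℝ → M) (t : ℝ) : TangentSpace 𝓘(ℝ, E) (γ t) :=
  mfderiv 𝓘(ℝ, ℝ) 𝓘(ℝ, E) γ t (1 : ℝ)

/-- `g(∇_{γ'} γ', w)` at the parameter `t`, in the preferred chart at `γ t`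
(`w` being a vector in that chart):
`G(x'', w) + Γ(x', x'; w)` where `x` is `γ` and `G` is `g` in the chart. -/
def accelerationPairing (g : LorentzMetric E M) (γ : ℝ → M) (t : ℝ) (w : E) : ℝ :=
  let e := extChartAt 𝓘(ℝ, E) (γ t)
  let G : E → E → E → ℝ := pullback g e.symm
  let x : ℝ → E := fun r ↦ e (γ r)
  G (x t) (deriv (deriv x) t) w + christoffelFirst G (x t) (deriv x t) (deriv x t) w

/-- `γ` restricted to the open interval `J` is an (affinely parametrized) null geodesic. -/
structure IsNullGeodesicOn (g : LorentzMetric E M) (γ : ℝ → M) (J : Set ℝ) : Prop where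
  isOpen : IsOpen J
  ordConnected : J.OrdConnected
  contMDiffOn : ContMDiffOn 𝓘(ℝ, ℝ) 𝓘(ℝ, E) ∞ γ J
  velocity_ne_zero : ∀ t ∈ J, velocity E γ t ≠ 0
  null : ∀ t ∈ J, g.inner (γ t) (velocity E γ t) (velocity E γ t) = 0
  geodesic : ∀ t ∈ J, ∀ w : E, accelerationPairing g γ t w = 0

/-- `φ` is a one-parameter group of isometries of `(M, g)`. -/
structure IsOneParameterIsometryGroup (g : LorentzMetric E M) (φ : ℝ → M → M) : Prop where
  contMDiff : ContMDiff (𝓘(ℝ, ℝ).prod 𝓘(ℝ, E)) 𝓘(ℝ, E) ∞ (fun q : ℝ × M ↦ φ q.1 q.2)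
  zero : ∀ x, φ 0 x = x
  add : ∀ a b x, φ (a + b) x = φ a (φ b x)
  isometry : ∀ (a : ℝ) (x : M) (X Y : TangentSpace 𝓘(ℝ, E) x),
    g.inner (φ a x) (mfderiv 𝓘(ℝ, E) 𝓘(ℝ, E) (φ a) x X)
      (mfderiv 𝓘(ℝ, E) 𝓘(ℝ, E) (φ a) x Y) = g.inner x X Y

/-- `γ` on `J` runs along an orbit of the one-parameter group of isometries `φ`, after a
reparametrization `s`: `γ u = φ_{s(u)} (p)`. -/
structure IsHomogeneousAlong (g : LorentzMetric E M) (γ : ℝ → M) (J : Set ℝ)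
    (φ : ℝ → M → M) (p : M) (s : ℝ → ℝ) : Prop where
  group : IsOneParameterIsometryGroup g φ
  contDiffOn : ContDiffOn ℝ ∞ s J
  orbit : ∀ u ∈ J, γ u = φ (s u) p

/-- Coordinates adapted to the portion `γ|_I` of a null geodesic. They are given by the inverse
`Φ : U → M` of the coordinate map, defined on an open neighbourhood `U` of the axis
`{(u, 0, 0) | u ∈ I}`. As `γ` may intersect itself, `Φ` is only asked to be a local diffeomorphism.
In these coordinates
`g = du dv + α dv² + ∑ βᵢ dyⁱ dv + ∑ Cᵢⱼ dyⁱ dyʲ` with `(Cᵢⱼ)` symmetric positive definite. -/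
structure AdaptedCoordinates (m : ℕ) (g : LorentzMetric E M) (γ : ℝ → M) (I : Set ℝ) where
  U : Set (Coord m)
  Φ : Coord m → M
  α : Coord m → ℝ
  β : Coord m → Fin m → ℝ
  C : Coord m → Matrix (Fin m) (Fin m) ℝ
  isOpen_interval : IsOpen I
  ordConnected : I.OrdConnected
  isOpen_U : IsOpen U
  axis_mem : ∀ u ∈ I, (u, 0, 0) ∈ U
  axis_eq : ∀ u ∈ I, Φ (u, 0, 0) = γ u
  localDiffeo : IsLocalDiffeoOn E Φ U
  posDef : ∀ z ∈ U, (C z).PosDef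
  metric : ∀ z ∈ U, ∀ X : Coord m, pullback g Φ z X X =
    X.1 * X.2.1 + α z * X.2.1 ^ 2 + (∑ i, β z i * X.2.2 i) * X.2.1
      + ∑ i, ∑ j, C z i j * X.2.2 i * X.2.2 j

end Spacetime

/-- `ψ_Ω (u, v, y) = (u, Ω² v, Ω y)`. -/
def rescale (m : ℕ) (Ω : ℝ) (z : Coord m) : Coord m := (z.1, Ω ^ 2 * z.2.1, Ω • z.2.2)

/-- The slab `{(u, v, y) | u ∈ I}`. It is the set of points which `ψ_Ω` moves, as `Ω → 0`, towards
the axis over `I`. -/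
def slab (m : ℕ) (I : Set ℝ) : Set (Coord m) := {z | z.1 ∈ I}

/-- `h` is the Penrose limit, on the slab over `I`, of `g` along `γ|_I`, computed in the adapted
coordinates `A`: `h = lim_{Ω → 0⁺} Ω⁻² ψ_Ω^* (Φ^* g)`. -/
def IsPenroseLimit {E : Type*} [NormedAddCommGroup E] [NormedSpace ℝ E]
    {M : Type*} [TopologicalSpace M] [ChartedSpace E M] [IsManifold 𝓘(ℝ, E) ∞ M] {m : ℕ}
    {g : LorentzMetric E M} {γ : ℝ → M} {I : Set ℝ}
    (A : AdaptedCoordinates m g γ I) (h : Coord m → Coord m → Coord m → ℝ) : Prop :=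
  ∀ z ∈ slab m I, ∀ X Y : Coord m,
    Tendsto (fun Ω : ℝ ↦ (Ω ^ 2)⁻¹ * pullback g (A.Φ ∘ rescale m Ω) z X Y) (𝓝[>] 0) (𝓝 (h z X Y))

section PlaneWave

variable {m : ℕ}

/-- `h` is the plane wave `du dv + ∑ Cᵢⱼ(u) dyⁱ dyʲ` on the slab over `I`. -/
structure IsPlaneWave (I : Set ℝ) (C : ℝ → Matrix (Fin m) (Fin m) ℝ)
    (h : Coord m → Coord m → Coord m → ℝ) : Prop where
  contDiffOn : ∀ i j, ContDiffOn ℝ ∞ (fun u ↦ C u i j) I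
  posDef : ∀ u ∈ I, (C u).PosDef
  metric : ∀ z ∈ slab m I, ∀ X Y : Coord m, h z X Y =
    (X.1 * Y.2.1 + X.2.1 * Y.1) / 2 + ∑ i, ∑ j, C z.1 i j * X.2.2 i * Y.2.2 j

/-- `f` is a (smooth) isometry from an open subset of `(S, h)` onto an open subset of `(T, k)`. -/
structure IsLocalIsometry (S : Set (Coord m)) (h : Coord m → Coord m → Coord m → ℝ)
    (T : Set (Coord m)) (k : Coord m → Coord m → Coord m → ℝ)
    (f : OpenPartialHomeomorph (Coord m) (Coord m)) : Prop where
  source_subset : f.source ⊆ S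
  target_subset : f.target ⊆ T
  contDiffOn : ContDiffOn ℝ ∞ f f.source
  contDiffOn_symm : ContDiffOn ℝ ∞ f.symm f.target
  metric : ∀ z ∈ f.source, ∀ X Y : Coord m,
    k (f z) (fderiv ℝ f z X) (fderiv ℝ f z Y) = h z X Y

/-- Some isometry from a neighbourhood of `p` in `(S, h)` onto a neighbourhood of `q` in `(T, k)`
maps `p` to `q`. -/
def LocallyIsometricAt (S : Set (Coord m)) (h : Coord m → Coord m → Coord m → ℝ)
    (T : Set (Coord m)) (k : Coord m → Coord m → Coord m → ℝ) (p q : Coord m) : Prop :=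
  ∃ f : OpenPartialHomeomorph (Coord m) (Coord m),
    IsLocalIsometry S h T k f ∧ p ∈ f.source ∧ f p = q

/-- `(S, h)` is locally homogeneous: its local isometries act transitively. -/
def IsLocallyHomogeneous (S : Set (Coord m)) (h : Coord m → Coord m → Coord m → ℝ) : Prop :=
  ∀ p ∈ S, ∀ q ∈ S, LocallyIsometricAt S h S h p q

/-- `(S, h)` is homogeneous: its isometry group acts transitively. -/
def IsHomogeneous (S : Set (Coord m)) (h : Coord m → Coord m → Coord m → ℝ) : Prop :=
  ∀ p ∈ S, ∀ q ∈ S, ∃ f : OpenPartialHomeomorph (Coord m) (Coord m),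
    IsLocalIsometry S h S h f ∧ f.source = S ∧ f.target = S ∧ f p = q

/-- `K` is a smooth Killing vector field of `(S, h)`: the Lie derivative of `h` along `K` is zero. -/
structure IsKilling (S : Set (Coord m)) (h : Coord m → Coord m → Coord m → ℝ)
    (K : Coord m → Coord m) : Prop where
  contDiffOn : ContDiffOn ℝ ∞ K S
  killing : ∀ z ∈ S, ∀ X Y : Coord m,
    fderiv ℝ (fun z' ↦ h z' X Y) z (K z) + h z (fderiv ℝ K z X) Y + h z X (fderiv ℝ K z Y) = 0

end PlaneWave

end PenroseLimit

end

/-! In adapted coordinates `∂_u` is null and `g(∂_u, Y) = Y_v / 2`. After rescaling, only `du dv`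
and the `dy dy` part on the axis survive, so the limit is the plane wave of `c(u) = C(u, 0, 0)`
(`AdaptedCoordinates.isPenroseLimit`). Translations in `v` and `y` act transitively on each leaf `u
= const`; what has to be found is an isometry that moves `u`.

It comes from the flow. With `t = s(u₂) - s(u₁)`, the isometry `φ_t` carries a piece of `γ` to
another piece along `ρ = s⁻¹ ∘ (s + t)`, and in adapted coordinates it is a local isometry `F` with
`F(u, 0, 0) = (ρ(u), 0, 0)`. Formally `ψ_Ω⁻¹ ∘ F ∘ ψ_Ω` tends to `(a u + b, v / a + Q(u)(y, y), A(u)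
y)`, where `A` is the transversal part of `dF` on the axis and `Q` is half the transversal Hessian
of the `v`-component of `F`. No limit of maps is taken: the needed identities are read off the
Taylor expansion of `F` at the axis. The isometry equation with `∂_u` as an argument gives, order by
order, that `ρ` is affine (`hasDerivAt_slope`), that `c₂(A' x, A y)` is symmetric
(`transversal_deriv_symm`), and that its `u`-derivative is `c₂(A' x, A' y)`
(`IsAxisIsometry.hasDerivAt_transversal_deriv`). These are exactly the conditions under which the
limit map is an isometry of plane waves (`PlaneTransport.isLocalIsometry`).

The infinitesimal version, applied to the generator of the flow, yields a Killing field whose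
`u`-component is `1 / s'` (`AdaptedCoordinates.planeKilling`); together with translations it spans
every tangent space. If `s(I) = ℝ`, then `ρ` is a bijection of all of `I`, and the local isometry is
defined on the whole slab. -/

open Set Filter Topology Bundle
open scoped Manifold ContDiff

noncomputable section

namespace PenroseLimit

/-! ### Pull-backs of the metric and their smoothness. -/

section Pullback

variable {E : Type*} [NormedAddCommGroup E] [NormedSpace ℝ E]
  {M : Type*} [TopologicalSpace M] [ChartedSpace E M] [IsManifold 𝓘(ℝ, E) ∞ M]
  {V : Type*} [NormedAddCommGroup V] [NormedSpace ℝ V]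
  {W : Type*} [NormedAddCommGroup W] [NormedSpace ℝ W]

/-- The pull-back of a metric as a field of continuous bilinear forms. -/
def pullbackForm (g : LorentzMetric E M) (Φ : V → M) (z : V) : V →L[ℝ] V →L[ℝ] ℝ :=
  let D : V →L[ℝ] E := mfderiv 𝓘(ℝ, V) 𝓘(ℝ, E) Φ z
  let B : E →L[ℝ] E →L[ℝ] ℝ := g.inner (Φ z)
  B.bilinearComp D D

lemma pullbackForm_apply (g : LorentzMetric E M) (Φ : V → M) (z X Y : V) :
    pullbackForm g Φ z X Y = pullback g Φ z X Y := rfl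

lemma pullback_symm (g : LorentzMetric E M) (Φ : V → M) (z X Y : V) :
    pullback g Φ z X Y = pullback g Φ z Y X := g.symm _ _ _

/-- The image of a constant vector under `dΦ` is a smooth section of the tangent bundle along `Φ`;
the metric is a smooth section of bilinear forms, evaluated on two such sections. -/
lemma contDiffAt_pullback (g : LorentzMetric E M) {Φ : V → M} {z : V}
    (hΦ : ContMDiffAt 𝓘(ℝ, V) 𝓘(ℝ, E) ∞ Φ z) (X Y : V) :
    ContDiffAt ℝ ∞ (fun z' ↦ pullback g Φ z' X Y) z := by
  have key : ∀ X : V, ContMDiffAt 𝓘(ℝ, V) (𝓘(ℝ, E).prod 𝓘(ℝ, E)) ∞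
      (fun z' ↦ TotalSpace.mk' E (E := fun x : M ↦ TangentSpace 𝓘(ℝ, E) x) (Φ z')
        (mfderiv 𝓘(ℝ, V) 𝓘(ℝ, E) Φ z' X)) z := by
    intro X
    rw [contMDiffAt_totalSpace]
    refine ⟨hΦ, ?_⟩
    have := ContMDiffAt.mfderiv_apply (fun _ : V ↦ Φ) id id (fun _ ↦ X) (x₀ := z) (m := ∞) (n := ∞)
      (hΦ.comp (z, z) contMDiffAt_snd) contMDiffAt_id contMDiffAt_id contMDiffAt_const (by simp)
    refine this.congr_of_eventuallyEq ?_
    have hs : ∀ᶠ z' in 𝓝 z, Φ z' ∈ (chartAt E (Φ z)).source :=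
      hΦ.continuousAt.eventually ((chartAt E (Φ z)).open_source.mem_nhds (mem_chart_source E _))
    filter_upwards [hs] with z' hz'
    refine Eq.trans ?_ (congrArg (fun T : V →L[ℝ] E ↦ T X)
      (inTangentCoordinates_eq (I := 𝓘(ℝ, V)) (I' := 𝓘(ℝ, E)) id Φ
        (fun x ↦ mfderiv 𝓘(ℝ, V) 𝓘(ℝ, E) Φ x) (x₀ := z) (x := z')
        (mem_chart_source V z') hz')).symm
    have hid : (tangentBundleCore 𝓘(ℝ, V) V).coordChange (achart V z) (achart V z') z' X = X := by
      rw [tangentBundleCore_coordChange_model_space]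
      rfl
    exact congrArg (fun Y : V ↦ (tangentBundleCore 𝓘(ℝ, E) M).coordChange (achart E (Φ z'))
      (achart E (Φ z)) (Φ z') (mfderiv 𝓘(ℝ, V) 𝓘(ℝ, E) Φ z' Y)) hid.symm
  have h := ContMDiffAt.clm_bundle_apply₂ (𝕜 := ℝ) (F₁ := E) (F₂ := E) (F₃ := ℝ)
    (E₁ := fun x : M ↦ TangentSpace 𝓘(ℝ, E) x) (E₂ := fun x : M ↦ TangentSpace 𝓘(ℝ, E) x)
    (E₃ := Bundle.Trivial M ℝ) (b := Φ) (ψ := fun z' ↦ g.inner (Φ z'))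
    (v := fun z' ↦ mfderiv 𝓘(ℝ, V) 𝓘(ℝ, E) Φ z' X)
    (w := fun z' ↦ mfderiv 𝓘(ℝ, V) 𝓘(ℝ, E) Φ z' Y)
    (g.contMDiff.contMDiffAt.comp z hΦ) (key X) (key Y)
  rw [contMDiffAt_totalSpace] at h
  exact h.2.contDiffAt

lemma contDiffOn_pullbackForm [FiniteDimensional ℝ V] (g : LorentzMetric E M) {Φ : V → M}
    {U : Set V} (hΦ : ∀ z ∈ U, ContMDiffAt 𝓘(ℝ, V) 𝓘(ℝ, E) ∞ Φ z) :
    ContDiffOn ℝ ∞ (pullbackForm g Φ) U := by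
  refine contDiffOn_clm_apply.2 fun X ↦ contDiffOn_clm_apply.2 fun Y z hz ↦ ?_
  exact (contDiffAt_pullback g (hΦ z hz) X Y).contDiffWithinAt

lemma pullback_comp (g : LorentzMetric E M) {Φ : V → M} {F : W → V} {z : W}
    (hΦ : MDifferentiableAt 𝓘(ℝ, V) 𝓘(ℝ, E) Φ (F z)) (hF : DifferentiableAt ℝ F z) (X Y : W) :
    pullback g (Φ ∘ F) z X Y = pullback g Φ (F z) (fderiv ℝ F z X) (fderiv ℝ F z Y) := by
  unfold pullback
  rw [mfderiv_comp z hΦ hF.mdifferentiableAt, mfderiv_eq_fderiv]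
  rfl

lemma pullback_congr (g : LorentzMetric E M) {Φ Ψ : V → M} {z : V} (h : Φ =ᶠ[𝓝 z] Ψ) (X Y : V) :
    pullback g Φ z X Y = pullback g Ψ z X Y := by
  unfold pullback
  rw [h.mfderiv_eq, h.self_of_nhds]

lemma IsOneParameterIsometryGroup.contMDiff_apply {g : LorentzMetric E M} {φ : ℝ → M → M}
    (hφ : IsOneParameterIsometryGroup g φ) (t : ℝ) :
    ContMDiff 𝓘(ℝ, E) 𝓘(ℝ, E) ∞ (φ t) :=
  hφ.contMDiff.comp (contMDiff_const.prodMk contMDiff_id)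

lemma IsOneParameterIsometryGroup.contMDiff_orbit {g : LorentzMetric E M} {φ : ℝ → M → M}
    (hφ : IsOneParameterIsometryGroup g φ) (x : M) :
    ContMDiff 𝓘(ℝ, ℝ) 𝓘(ℝ, E) ∞ (fun t ↦ φ t x) :=
  hφ.contMDiff.comp (contMDiff_id.prodMk contMDiff_const)

lemma IsOneParameterIsometryGroup.pullback_comp {g : LorentzMetric E M} {φ : ℝ → M → M}
    (hφ : IsOneParameterIsometryGroup g φ) (t : ℝ) {Φ : V → M} {z : V}
    (hΦ : MDifferentiableAt 𝓘(ℝ, V) 𝓘(ℝ, E) Φ z) (X Y : V) :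
    pullback g (φ t ∘ Φ) z X Y = pullback g Φ z X Y := by
  unfold pullback
  rw [mfderiv_comp z ((hφ.contMDiff_apply t).mdifferentiable (by simp) _) hΦ]
  exact hφ.isometry t _ _ _

end Pullback

/-! ### Bilinear forms of adapted shape, and higher derivatives near a zero. -/

section AxisMetric

variable {m : ℕ}

/-- The coordinate vector `∂_u`. -/
def eu (m : ℕ) : Coord m := (1, 0, 0)

/-- The coordinate vector `∂_v`. -/
def ev (m : ℕ) : Coord m := (0, 1, 0)

/-- The point `(u, 0, 0)` of the axis. -/
def axis (m : ℕ) (u : ℝ) : Coord m := (u, 0, 0)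

/-- The embedding of the transversal directions. -/
def ey (m : ℕ) : (Fin m → ℝ) →L[ℝ] Coord m :=
  (ContinuousLinearMap.inr ℝ ℝ (ℝ × (Fin m → ℝ))).comp (ContinuousLinearMap.inr ℝ ℝ (Fin m → ℝ))

/-- The `v`-component of a vector. -/
def pv (m : ℕ) : Coord m →L[ℝ] ℝ :=
  (ContinuousLinearMap.fst ℝ ℝ (Fin m → ℝ)).comp
    (ContinuousLinearMap.snd ℝ ℝ (ℝ × (Fin m → ℝ)))

/-- The transversal component of a vector. -/
def py (m : ℕ) : Coord m →L[ℝ] (Fin m → ℝ) :=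
  (ContinuousLinearMap.snd ℝ ℝ (Fin m → ℝ)).comp
    (ContinuousLinearMap.snd ℝ ℝ (ℝ × (Fin m → ℝ)))

@[simp] lemma pv_apply (X : Coord m) : pv m X = X.2.1 := rfl
@[simp] lemma py_apply (X : Coord m) : py m X = X.2.2 := rfl
lemma ey_apply (y : Fin m → ℝ) : ey m y = (0, 0, y) := rfl

lemma hasDerivAt_axis (u : ℝ) : HasDerivAt (axis m) (eu m) u :=
  (hasDerivAt_id u).prodMk (hasDerivAt_const u (0 : ℝ × (Fin m → ℝ)))

lemma contDiff_axis : ContDiff ℝ ∞ (axis m) := contDiff_id.prodMk contDiff_const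

lemma continuous_axis : Continuous (axis m) := contDiff_axis.continuous

lemma eq_smul_eu_add (X : Coord m) : X = X.1 • eu m + X.2.1 • ev m + ey m X.2.2 := by
  simp [eu, ev, ey_apply]

/-- A field of bilinear forms on `U` which has the shape `du dv + (terms without du)`. -/
structure IsAdaptedForm (G : Coord m → Coord m →L[ℝ] Coord m →L[ℝ] ℝ) (U : Set (Coord m)) :
    Prop where
  isOpen : IsOpen U
  contDiffOn : ContDiffOn ℝ ∞ G U
  symm : ∀ z ∈ U, ∀ X Y, G z X Y = G z Y X
  apply_eu : ∀ z ∈ U, ∀ Y, G z (eu m) Y = Y.2.1 / 2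

/-- The restriction of `G` to the transversal directions, along the axis. -/
def transversal (G : Coord m → Coord m →L[ℝ] Coord m →L[ℝ] ℝ) (u : ℝ) :
    (Fin m → ℝ) →L[ℝ] (Fin m → ℝ) →L[ℝ] ℝ :=
  (G (axis m u)).bilinearComp (ey m) (ey m)

lemma transversal_apply (G : Coord m → Coord m →L[ℝ] Coord m →L[ℝ] ℝ) (u : ℝ)
    (x y : Fin m → ℝ) : transversal G u x y = G (axis m u) (ey m x) (ey m y) := rfl

namespace IsAdaptedForm

variable {G : Coord m → Coord m →L[ℝ] Coord m →L[ℝ] ℝ} {U : Set (Coord m)}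

lemma apply_eu' (hG : IsAdaptedForm G U) {z : Coord m} (hz : z ∈ U) (Y : Coord m) :
    G z Y (eu m) = Y.2.1 / 2 := by rw [hG.symm z hz, hG.apply_eu z hz]

/-- `∂_u` is null and orthogonal to every vector without `∂_v`-component, so the `∂_u`-components
drop out. -/
lemma apply_of_null (hG : IsAdaptedForm G U) {z : Coord m} (hz : z ∈ U) {X Y : Coord m}
    (hX : X.2.1 = 0) (hY : Y.2.1 = 0) : G z X Y = G z (ey m X.2.2) (ey m Y.2.2) := by
  conv_lhs => rw [eq_smul_eu_add X, eq_smul_eu_add Y]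
  have h : (eu m).2.1 = 0 := rfl
  simp [hX, hY, hG.apply_eu z hz, hG.apply_eu' hz, ey_apply, h]

lemma contDiffAt (hG : IsAdaptedForm G U) {z : Coord m} (hz : z ∈ U) : ContDiffAt ℝ ∞ G z :=
  hG.contDiffOn.contDiffAt (hG.isOpen.mem_nhds hz)

lemma contDiffAt_transversal (hG : IsAdaptedForm G U) {u : ℝ} (hu : axis m u ∈ U) :
    ContDiffAt ℝ ∞ (transversal G) u := by
  have hs : ContDiffOn ℝ ∞ (transversal G) (axis m ⁻¹' U) := by
    refine contDiffOn_clm_apply.2 fun x ↦ contDiffOn_clm_apply.2 fun y u hu ↦ ?_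
    have h : ContDiffAt ℝ ∞ (fun u ↦ G (axis m u)) u :=
      ContDiffAt.comp u (hG.contDiffAt hu) contDiff_axis.contDiffAt
    exact ((h.clm_apply contDiffAt_const).clm_apply contDiffAt_const).contDiffWithinAt
  exact hs.contDiffAt ((hG.isOpen.preimage continuous_axis).mem_nhds hu)

end IsAdaptedForm

section ThirdDerivative

variable {V W : Type*} [NormedAddCommGroup V] [NormedSpace ℝ V]
  [NormedAddCommGroup W] [NormedSpace ℝ W] {F : V → W} {z : V}

lemma fderiv_fderiv_comm (hF : ContDiffAt ℝ ∞ F z) (X Y : V) :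
    fderiv ℝ (fderiv ℝ F) z X Y = fderiv ℝ (fderiv ℝ F) z Y X :=
  hF.isSymmSndFDerivAt (by simpa using (ENat.LEInfty.out : (2 : WithTop ℕ∞) ≤ ∞)) X Y

lemma contDiffAt_fderiv (hF : ContDiffAt ℝ ∞ F z) : ContDiffAt ℝ ∞ (fderiv ℝ F) z :=
  hF.fderiv_right (by simp)

lemma differentiableAt_fderiv (hF : ContDiffAt ℝ ∞ F z) : DifferentiableAt ℝ (fderiv ℝ F) z :=
  (contDiffAt_fderiv hF).differentiableAt (by simp)

lemma fderiv_fderiv_apply (hF : ContDiffAt ℝ ∞ F z) (X Y : V) :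
    fderiv ℝ (fun z ↦ fderiv ℝ F z Y) z X = fderiv ℝ (fderiv ℝ F) z X Y := by
  rw [((differentiableAt_fderiv hF).hasFDerivAt.clm_apply (hasFDerivAt_const Y z)).fderiv]
  simp

/-- The third derivative `∂_N ∂_X ∂_Y F` is also `∂_X ∂_Y (∂_N F)`. -/
lemma fderiv_fderiv_fderiv_rotate {s : Set V} (hs : IsOpen s) (hF : ContDiffOn ℝ ∞ F s)
    (hz : z ∈ s) (N X Y : V) :
    fderiv ℝ (fderiv ℝ (fderiv ℝ F)) z N X Y
      = fderiv ℝ (fun z' ↦ fderiv ℝ (fun z'' ↦ fderiv ℝ F z'' N) z' Y) z X := by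
  have hat : ∀ z' ∈ s, ContDiffAt ℝ ∞ F z' := fun z' h ↦ hF.contDiffAt (hs.mem_nhds h)
  have hev : (fun z' ↦ fderiv ℝ (fun z'' ↦ fderiv ℝ F z'' N) z' Y) =ᶠ[𝓝 z]
      fun z' ↦ fderiv ℝ (fderiv ℝ F) z' N Y := by
    filter_upwards [hs.mem_nhds hz] with z' hz'
    rw [fderiv_fderiv_apply (hat z' hz'), fderiv_fderiv_comm (hat z' hz')]
  have hd := differentiableAt_fderiv (contDiffAt_fderiv (hat z hz))
  rw [hev.fderiv_eq, fderiv_fderiv_comm (contDiffAt_fderiv (hat z hz)),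
    ((hd.hasFDerivAt.clm_apply (hasFDerivAt_const N z)).clm_apply (hasFDerivAt_const Y z)).fderiv]
  simp

end ThirdDerivative

section Bilinear

variable {V W : Type*} [NormedAddCommGroup V] [NormedSpace ℝ V]
  [NormedAddCommGroup W] [NormedSpace ℝ W]

/-- The derivative of `B(r, w)` at a zero of `r`. -/
lemma fderiv_bilinear_of_eq_zero {B : V → W →L[ℝ] W →L[ℝ] ℝ} {r w : V → W} {z : V}
    (hB : DifferentiableAt ℝ B z) (hr : DifferentiableAt ℝ r z) (hw : DifferentiableAt ℝ w z)
    (h0 : r z = 0) (X : V) :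
    fderiv ℝ (fun z ↦ B z (r z) (w z)) z X = B z (fderiv ℝ r z X) (w z) := by
  have h := ((hB.hasFDerivAt.clm_apply hr.hasFDerivAt).clm_apply hw.hasFDerivAt).fderiv
  rw [h]
  simp [h0]

set_option synthInstance.maxHeartbeats 200000 in
/-- The Hessian of `B(r, r)` at a zero of `r`. -/
lemma fderiv_fderiv_bilinear_of_eq_zero {B : V → W →L[ℝ] W →L[ℝ] ℝ} {r : V → W} {z : V}
    (hB : ContDiffAt ℝ ∞ B z) (hr : ContDiffAt ℝ ∞ r z)
    (hsymm : ∀ᶠ z' in 𝓝 z, ∀ X Y, B z' X Y = B z' Y X) (h0 : r z = 0) (X Y : V) :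
    fderiv ℝ (fun z' ↦ fderiv ℝ (fun z ↦ B z (r z) (r z)) z' Y) z X
      = 2 * B z (fderiv ℝ r z X) (fderiv ℝ r z Y) := by
  have hB' : ContDiffAt ℝ ∞ (fun z ↦ fderiv ℝ B z Y) z :=
    (contDiffAt_fderiv hB).clm_apply contDiffAt_const
  have hr' : ContDiffAt ℝ ∞ (fun z ↦ fderiv ℝ r z Y) z :=
    (contDiffAt_fderiv hr).clm_apply contDiffAt_const
  have hev : (fun z' ↦ fderiv ℝ (fun z ↦ B z (r z) (r z)) z' Y) =ᶠ[𝓝 z]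
      fun z' ↦ (fderiv ℝ B z' Y) (r z') (r z') + 2 * B z' (r z') (fderiv ℝ r z' Y) := by
    have h1 := (hB.of_le (m := 1) (by simp)).eventually (by simp)
    have h2 := (hr.of_le (m := 1) (by simp)).eventually (by simp)
    filter_upwards [h1, h2, hsymm] with z' h1 h2 h3
    have h1 := h1.differentiableAt (by simp)
    have h2 := h2.differentiableAt (by simp)
    rw [((h1.hasFDerivAt.clm_apply h2.hasFDerivAt).clm_apply h2.hasFDerivAt).fderiv]
    simp [h3 (fderiv ℝ r z' Y) (r z')]
    ring
  rw [hev.fderiv_eq, fderiv_fun_add, fderiv_const_mul]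
  · have hd := hr.differentiableAt (by simp)
    simp only [add_apply, smul_apply]
    rw [fderiv_bilinear_of_eq_zero (hB'.differentiableAt (by simp)) hd hd h0,
      fderiv_bilinear_of_eq_zero (hB.differentiableAt (by simp)) hd
        (hr'.differentiableAt (by simp)) h0, h0]
    simp
  · exact ((hB.clm_apply hr).clm_apply hr').differentiableAt (by simp)
  · exact ((hB'.clm_apply hr).clm_apply hr).differentiableAt (by simp)
  · exact (((hB.clm_apply hr).clm_apply hr').differentiableAt (by simp)).const_mul _

end Bilinear

end AxisMetric

/-! ### Taylor expansion, along the axis, of an isometry that preserves the axis. -/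

section AxisIsometry

variable {m : ℕ}

/-- A smooth isometry between open sets with adapted forms which maps the axis to the axis. -/
structure IsAxisIsometry (G₁ : Coord m → Coord m →L[ℝ] Coord m →L[ℝ] ℝ) (U₁ : Set (Coord m))
    (G₂ : Coord m → Coord m →L[ℝ] Coord m →L[ℝ] ℝ) (U₂ : Set (Coord m))
    (F : Coord m → Coord m) (ρ : ℝ → ℝ) : Prop where
  source : IsAdaptedForm G₁ U₁
  target : IsAdaptedForm G₂ U₂
  contDiffOn : ContDiffOn ℝ ∞ F U₁
  mapsTo : MapsTo F U₁ U₂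
  isometry : ∀ z ∈ U₁, ∀ X Y, G₂ (F z) (fderiv ℝ F z X) (fderiv ℝ F z Y) = G₁ z X Y
  map_axis : ∀ u, axis m u ∈ U₁ → F (axis m u) = axis m (ρ u)

/-- The transversal part of the derivative of `F` along the axis. -/
def transversalDeriv (F : Coord m → Coord m) (u : ℝ) : (Fin m → ℝ) →L[ℝ] (Fin m → ℝ) :=
  (py m).comp ((fderiv ℝ F (axis m u)).comp (ey m))

lemma contDiffAt_transversalDeriv {F : Coord m → Coord m} {u : ℝ}
    (hF : ContDiffAt ℝ ∞ F (axis m u)) : ContDiffAt ℝ ∞ (transversalDeriv F) u := by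
  have h : ContDiffAt ℝ ∞ (fun u ↦ fderiv ℝ F (axis m u)) u :=
    ContDiffAt.comp u (contDiffAt_fderiv hF) contDiff_axis.contDiffAt
  exact contDiffAt_const.clm_comp (h.clm_comp contDiffAt_const)

lemma deriv_transversalDeriv_apply {F : Coord m → Coord m} {u : ℝ}
    (hF : ContDiffAt ℝ ∞ F (axis m u)) (x : Fin m → ℝ) :
    deriv (transversalDeriv F) u x
      = (fderiv ℝ (fderiv ℝ F) (axis m u) (eu m) (ey m x)).2.2 := by
  have h1 := ((contDiffAt_transversalDeriv hF).differentiableAt (by simp)).hasDerivAt.clm_apply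
    (hasDerivAt_const u x)
  have h2 := ((differentiableAt_fderiv hF).hasFDerivAt.comp_hasDerivAt u
    (hasDerivAt_axis u)).clm_apply (hasDerivAt_const u (ey m x))
  have h3 := (py m).hasFDerivAt.comp_hasDerivAt u h2
  have := h1.unique h3
  simpa using this

lemma hasDerivAt_fderiv_axis {F : Coord m → Coord m} {u : ℝ}
    (hF : ContDiffAt ℝ ∞ F (axis m u)) (X : Coord m) :
    HasDerivAt (fun u ↦ fderiv ℝ F (axis m u) X)
      (fderiv ℝ (fderiv ℝ F) (axis m u) (eu m) X) u := by
  simpa using ((differentiableAt_fderiv hF).hasFDerivAt.comp_hasDerivAt u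
    (hasDerivAt_axis u)).clm_apply (hasDerivAt_const u X)

lemma fderiv_pv_comp {f : Coord m → Coord m} {z : Coord m} (hf : DifferentiableAt ℝ f z)
    (X : Coord m) : fderiv ℝ (fun z ↦ pv m (f z)) z X = (fderiv ℝ f z X).2.1 := by
  have h : HasFDerivAt (fun z ↦ pv m (f z)) ((pv m).comp (fderiv ℝ f z)) z :=
    (pv m).hasFDerivAt.comp z hf.hasFDerivAt
  rw [h.fderiv]
  rfl

namespace IsAxisIsometry

variable {G₁ G₂ : Coord m → Coord m →L[ℝ] Coord m →L[ℝ] ℝ} {U₁ U₂ : Set (Coord m)}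
  {F : Coord m → Coord m} {ρ : ℝ → ℝ}

lemma contDiffAt (h : IsAxisIsometry G₁ U₁ G₂ U₂ F ρ) {z : Coord m} (hz : z ∈ U₁) :
    ContDiffAt ℝ ∞ F z := h.contDiffOn.contDiffAt (h.source.isOpen.mem_nhds hz)

lemma eventually_axis_mem (h : IsAxisIsometry G₁ U₁ G₂ U₂ F ρ) {u : ℝ} (hu : axis m u ∈ U₁) :
    ∀ᶠ t in 𝓝 u, axis m t ∈ U₁ :=
  (h.source.isOpen.preimage continuous_axis).mem_nhds hu

/-- The derivative of the axis map. -/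
def slope (_ : IsAxisIsometry G₁ U₁ G₂ U₂ F ρ) (u : ℝ) : ℝ :=
  (fderiv ℝ F (axis m u) (eu m)).1

lemma fderiv_eu (h : IsAxisIsometry G₁ U₁ G₂ U₂ F ρ) {u : ℝ} (hu : axis m u ∈ U₁) :
    HasDerivAt ρ (h.slope u) u ∧
      fderiv ℝ F (axis m u) (eu m) = h.slope u • eu m := by
  have h1 : HasDerivAt (fun u ↦ F (axis m u))
      (fderiv ℝ F (axis m u) (eu m)) u :=
    ((h.contDiffAt hu).differentiableAt (by simp)).hasFDerivAt.comp_hasDerivAt u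
      (hasDerivAt_axis u)
  have h2 : HasDerivAt (fun u ↦ axis m (ρ u))
      (fderiv ℝ F (axis m u) (eu m)) u := by
    refine h1.congr_of_eventuallyEq ?_
    filter_upwards [h.eventually_axis_mem hu] with t ht using (h.map_axis t ht).symm
  have h3 : HasDerivAt ρ (h.slope u) u :=
    (ContinuousLinearMap.fst ℝ ℝ (ℝ × (Fin m → ℝ))).hasFDerivAt.comp_hasDerivAt u h2
  refine ⟨h3, ?_⟩
  have h4 := h2.unique ((hasDerivAt_axis (m := m) (ρ u)).scomp u h3)
  exact h4

lemma apply_fderiv_eu (h : IsAxisIsometry G₁ U₁ G₂ U₂ F ρ) {z : Coord m} (hz : z ∈ U₁)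
    (Y : Coord m) : G₂ (F z) (fderiv ℝ F z (eu m)) (fderiv ℝ F z Y) = Y.2.1 / 2 := by
  rw [h.isometry z hz, h.source.apply_eu z hz]

/-- Pairing with `∂_u` reads off half the `v`-component on both sides, and on the axis `dF ∂_u` is a
multiple of `∂_u`. -/
lemma slope_mul (h : IsAxisIsometry G₁ U₁ G₂ U₂ F ρ) {u : ℝ} (hu : axis m u ∈ U₁)
    (Y : Coord m) : h.slope u * (fderiv ℝ F (axis m u) Y).2.1 = Y.2.1 := by
  have h1 := h.apply_fderiv_eu hu Y
  rw [(h.fderiv_eu hu).2, map_smul, smul_apply, h.target.apply_eu _ (h.mapsTo hu),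
    smul_eq_mul] at h1
  linarith

lemma slope_ne_zero (h : IsAxisIsometry G₁ U₁ G₂ U₂ F ρ) {u : ℝ}
    (hu : axis m u ∈ U₁) : h.slope u ≠ 0 := by
  intro h0
  simpa [h0, ev] using h.slope_mul hu (ev m)

lemma fderiv_ey_null (h : IsAxisIsometry G₁ U₁ G₂ U₂ F ρ) {u : ℝ}
    (hu : axis m u ∈ U₁) (y : Fin m → ℝ) :
    (fderiv ℝ F (axis m u) (ey m y)).2.1 = 0 := by
  simpa [ey_apply, h.slope_ne_zero hu] using h.slope_mul hu (ey m y)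

lemma apply_axis_of_null (h : IsAxisIsometry G₁ U₁ G₂ U₂ F ρ) {u : ℝ}
    (hu : axis m u ∈ U₁) {X Y : Coord m} (hX : X.2.1 = 0) (hY : Y.2.1 = 0) :
    G₂ (F (axis m u)) X Y = transversal G₂ (ρ u) X.2.2 Y.2.2 := by
  rw [h.target.apply_of_null (h.mapsTo hu) hX hY, h.map_axis u hu, transversal_apply]

lemma transversal_eq (h : IsAxisIsometry G₁ U₁ G₂ U₂ F ρ) {u : ℝ}
    (hu : axis m u ∈ U₁) (x y : Fin m → ℝ) :
    transversal G₂ (ρ u) (transversalDeriv F u x) (transversalDeriv F u y)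
      = transversal G₁ u x y := by
  rw [transversal_apply G₁, ← h.isometry _ hu,
    h.apply_axis_of_null hu (h.fderiv_ey_null hu x) (h.fderiv_ey_null hu y)]
  rfl

/-- The derivative of the deviation of `F_* ∂_u` from a multiple of `∂_u`. -/
lemma fderiv_remainder (h : IsAxisIsometry G₁ U₁ G₂ U₂ F ρ) {z : Coord m} (hz : z ∈ U₁) (a : ℝ)
    (X : Coord m) : fderiv ℝ (fun z ↦ fderiv ℝ F z (eu m) - a • eu m) z X
      = fderiv ℝ (fderiv ℝ F) z X (eu m) := by
  rw [fderiv_sub_const, fderiv_fderiv_apply (h.contDiffAt hz)]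

/-- For constant `Y` the pairing `G₂(dF ∂_u, dF Y)` is the constant `Y_v / 2`. Split `dF ∂_u = a ∂_u
+ r` with `a` frozen at the chosen point: the first part contributes `a (dF Y)_v / 2`, and since `r`
vanishes at that point, differentiating the second part involves no derivative of `G₂`. -/
lemma hessian_eq (h : IsAxisIsometry G₁ U₁ G₂ U₂ F ρ) {u : ℝ} (hu : axis m u ∈ U₁)
    (X Y : Coord m) :
    h.slope u / 2 * (fderiv ℝ (fderiv ℝ F) (axis m u) X Y).2.1
      + G₂ (F (axis m u)) (fderiv ℝ (fderiv ℝ F) (axis m u) X (eu m))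
        (fderiv ℝ F (axis m u) Y) = 0 := by
  set z₀ := axis m u
  set r : Coord m → Coord m := fun z ↦ fderiv ℝ F z (eu m) - h.slope u • eu m with hr
  have hr0 : r z₀ = 0 := by simp [hr, z₀, (h.fderiv_eu hu).2]
  have hF := h.contDiffAt hu
  have hdF := contDiffAt_fderiv hF
  have hrd : DifferentiableAt ℝ r z₀ :=
    ((hdF.clm_apply contDiffAt_const).sub contDiffAt_const).differentiableAt (by simp)
  have hB : DifferentiableAt ℝ (fun z ↦ G₂ (F z)) z₀ :=
    (ContDiffAt.comp z₀ (h.target.contDiffAt (h.mapsTo hu)) hF).differentiableAt (by simp)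
  have hw : DifferentiableAt ℝ (fun z ↦ fderiv ℝ F z Y) z₀ :=
    (hdF.clm_apply contDiffAt_const).differentiableAt (by simp)
  have hev : (fun z ↦ h.slope u / 2 * (pv m (fderiv ℝ F z Y)) + G₂ (F z) (r z) (fderiv ℝ F z Y))
      =ᶠ[𝓝 z₀] fun _ ↦ Y.2.1 / 2 := by
    filter_upwards [h.source.isOpen.mem_nhds hu] with z hz
    have := h.apply_fderiv_eu hz Y
    simp only [hr, map_sub, map_smul, sub_apply, smul_apply,
      h.target.apply_eu _ (h.mapsTo hz), this, smul_eq_mul, pv_apply]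
    ring
  have h1 := hev.fderiv_eq (𝕜 := ℝ)
  rw [fderiv_fun_const, fderiv_fun_add, fderiv_const_mul] at h1
  · have h2 := DFunLike.congr_fun h1 X
    simp only [add_apply, smul_apply] at h2
    rw [fderiv_bilinear_of_eq_zero hB hrd hw hr0, h.fderiv_remainder hu] at h2
    have h3 : fderiv ℝ (fun z ↦ pv m (fderiv ℝ F z Y)) z₀ X
        = (fderiv ℝ (fderiv ℝ F) z₀ X Y).2.1 := by
      rw [← fderiv_fderiv_apply hF, fderiv_pv_comp hw]
    rw [h3] at h2
    simpa using h2
  · exact ((pv m).hasFDerivAt.comp z₀ hw.hasFDerivAt).differentiableAt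
  · exact (((pv m).hasFDerivAt.comp z₀ hw.hasFDerivAt).differentiableAt).const_mul _
  · exact (hB.clm_apply hrd).clm_apply hw

lemma hessian_eu_null (h : IsAxisIsometry G₁ U₁ G₂ U₂ F ρ) {u : ℝ}
    (hu : axis m u ∈ U₁) (X : Coord m) :
    (fderiv ℝ (fderiv ℝ F) (axis m u) X (eu m)).2.1 = 0 := by
  have h1 := h.hessian_eq hu X (eu m)
  rw [(h.fderiv_eu hu).2, map_smul, h.target.apply_eu' (h.mapsTo hu), smul_eq_mul] at h1
  have : h.slope u * (fderiv ℝ (fderiv ℝ F) (axis m u) X (eu m)).2.1 = 0 := by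
    linarith
  exact (mul_eq_zero.1 this).resolve_left (h.slope_ne_zero hu)

/-- This makes `ρ` affine. On the axis `D²F(∂_u, ∂_u)` is `a' ∂_u`; in `hessian_eq` for `∂_u` and
`∂_v` the first term vanishes by `hessian_eu_null`, which leaves `a' (dF ∂_v)_v = 0`, where `(dF
∂_v)_v = 1 / a`. -/
lemma hasDerivAt_slope (h : IsAxisIsometry G₁ U₁ G₂ U₂ F ρ) {u : ℝ}
    (hu : axis m u ∈ U₁) : HasDerivAt h.slope 0 u := by
  have hF := h.contDiffAt hu
  have h1 := hasDerivAt_fderiv_axis hF (eu m)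
  have h2 : HasDerivAt h.slope
      (fderiv ℝ (fderiv ℝ F) (axis m u) (eu m) (eu m)).1 u :=
    (ContinuousLinearMap.fst ℝ ℝ (ℝ × (Fin m → ℝ))).hasFDerivAt.comp_hasDerivAt u h1
  have h3 : HasDerivAt (fun u ↦ h.slope u • eu m)
      (fderiv ℝ (fderiv ℝ F) (axis m u) (eu m) (eu m)) u := by
    refine h1.congr_of_eventuallyEq ?_
    filter_upwards [h.eventually_axis_mem hu] with t ht using (h.fderiv_eu ht).2.symm
  have h4 := h3.unique (h2.smul_const (eu m))
  have h5 := h.hessian_eq hu (eu m) (ev m)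
  have h6 := h.slope_mul hu (ev m)
  have h7 := h.hessian_eu_null hu (ev m)
  rw [fderiv_fderiv_comm hF] at h7
  rw [h7, h4, map_smul, smul_apply, h.target.apply_eu _ (h.mapsTo hu), smul_eq_mul] at h5
  have h8 : (fderiv ℝ F (axis m u) (ev m)).2.1 ≠ 0 := by
    intro h0
    rw [h0] at h6
    simp [ev] at h6
  have h9 : (fderiv ℝ (fderiv ℝ F) (axis m u) (eu m) (eu m)).1 = 0 := by
    simpa [h8] using h5
  rwa [h9] at h2

/-- Identifies the form built from `A'` and `A` with a multiple of the transversal Hessian of the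
`v`-component of `F`; its symmetry and its derivative in `u` thereby become statements about higher
derivatives of `F`. -/
lemma transversal_deriv_eq (h : IsAxisIsometry G₁ U₁ G₂ U₂ F ρ) {u : ℝ}
    (hu : axis m u ∈ U₁) (x y : Fin m → ℝ) :
    transversal G₂ (ρ u) (deriv (transversalDeriv F) u x) (transversalDeriv F u y)
      = -(h.slope u / 2)
        * (fderiv ℝ (fderiv ℝ F) (axis m u) (ey m x) (ey m y)).2.1 := by
  have hF := h.contDiffAt hu
  have h1 := h.hessian_eq hu (ey m x) (ey m y)
  rw [h.apply_axis_of_null hu (h.hessian_eu_null hu _) (h.fderiv_ey_null hu _),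
    fderiv_fderiv_comm hF (ey m x) (eu m), ← deriv_transversalDeriv_apply hF] at h1
  change _ + transversal G₂ (ρ u) _ (transversalDeriv F u y) = 0 at h1
  linarith

lemma transversal_deriv_symm (h : IsAxisIsometry G₁ U₁ G₂ U₂ F ρ) {u : ℝ}
    (hu : axis m u ∈ U₁) (x y : Fin m → ℝ) :
    transversal G₂ (ρ u) (deriv (transversalDeriv F) u x) (transversalDeriv F u y)
      = transversal G₂ (ρ u) (deriv (transversalDeriv F) u y) (transversalDeriv F u x) := by
  rw [h.transversal_deriv_eq hu, h.transversal_deriv_eq hu, fderiv_fderiv_comm (h.contDiffAt hu)]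

/-- `dF ∂_u = a ∂_u + r` is null, which reads `a (dF ∂_u)_v + G₂(r, r) = 0` on all of `U₁`. As `r`
vanishes at the axis point, the Hessian of `G₂(r, r)` there is `2 G₂(∂_X r, ∂_Y r)`, and `∂_X r =
D²F(X, ∂_u)`. -/
lemma third_derivative_eq (h : IsAxisIsometry G₁ U₁ G₂ U₂ F ρ) {u : ℝ}
    (hu : axis m u ∈ U₁) (X Y : Coord m) :
    h.slope u / 2 *
      (fderiv ℝ (fderiv ℝ (fderiv ℝ F)) (axis m u) (eu m) X Y).2.1
      = - G₂ (F (axis m u))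
        (fderiv ℝ (fderiv ℝ F) (axis m u) X (eu m))
        (fderiv ℝ (fderiv ℝ F) (axis m u) Y (eu m)) := by
  set z₀ := axis m u
  set a := h.slope u
  set r : Coord m → Coord m := fun z ↦ fderiv ℝ F z (eu m) - a • eu m with hr
  have ha : a ≠ 0 := h.slope_ne_zero hu
  have hr0 : r z₀ = 0 := by simp [hr, z₀, a, (h.fderiv_eu hu).2]
  have hF := h.contDiffAt hu
  have hr' : ContDiffAt ℝ ∞ r z₀ :=
    ((contDiffAt_fderiv hF).clm_apply contDiffAt_const).sub contDiffAt_const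
  have hB : ContDiffAt ℝ ∞ (fun z ↦ G₂ (F z)) z₀ :=
    ContDiffAt.comp z₀ (h.target.contDiffAt (h.mapsTo hu)) hF
  have hU := h.source.isOpen.mem_nhds hu
  have hk := fderiv_fderiv_bilinear_of_eq_zero hB hr'
    (by filter_upwards [hU] with z hz using h.target.symm _ (h.mapsTo hz)) hr0 X Y
  rw [h.fderiv_remainder hu, h.fderiv_remainder hu] at hk
  have hev : ∀ z ∈ U₁, pv m (fderiv ℝ F z (eu m)) = -a⁻¹ * G₂ (F z) (r z) (r z) := by
    intro z hz
    have h0 := h.apply_fderiv_eu hz (eu m)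
    have he := h.target.apply_eu _ (h.mapsTo hz)
    have he' := fun Y ↦ h.target.apply_eu' (h.mapsTo hz) Y
    have h00 : (eu m).2.1 = 0 := rfl
    rw [h00] at h0
    simp only [hr, map_sub, map_smul, sub_apply, smul_apply, he, he', h0, h00, smul_eq_mul,
      pv_apply]
    field_simp
    ring
  have hD : ContDiffOn ℝ ∞ (fun z ↦ fderiv ℝ F z (eu m)) U₁ := fun z hz ↦
    ((contDiffAt_fderiv (h.contDiffAt hz)).clm_apply contDiffAt_const).contDiffWithinAt
  have hDat : ∀ z ∈ U₁, ContDiffAt ℝ ∞ (fun z ↦ fderiv ℝ F z (eu m)) z := fun z hz ↦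
    hD.contDiffAt (h.source.isOpen.mem_nhds hz)
  have hev2 : ∀ z ∈ U₁, (fderiv ℝ (fun z ↦ fderiv ℝ F z (eu m)) z Y).2.1
      = -a⁻¹ * fderiv ℝ (fun z ↦ G₂ (F z) (r z) (r z)) z Y := by
    intro z hz
    have h1 : (fun z ↦ pv m (fderiv ℝ F z (eu m))) =ᶠ[𝓝 z]
        fun z ↦ -a⁻¹ * G₂ (F z) (r z) (r z) := by
      filter_upwards [h.source.isOpen.mem_nhds hz] with z' hz' using hev z' hz'
    have h2 := DFunLike.congr_fun (h1.fderiv_eq (𝕜 := ℝ)) Y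
    have hd : DifferentiableAt ℝ (fun z ↦ G₂ (F z) (r z) (r z)) z := by
      have hrz : ContDiffAt ℝ ∞ r z := (hDat z hz).sub contDiffAt_const
      exact (((ContDiffAt.comp z (h.target.contDiffAt (h.mapsTo hz)) (h.contDiffAt hz)).clm_apply
        hrz).clm_apply hrz).differentiableAt (by simp)
    rw [fderiv_const_mul hd] at h2
    rwa [fderiv_pv_comp ((hDat z hz).differentiableAt (by simp))] at h2
  rw [fderiv_fderiv_fderiv_rotate h.source.isOpen h.contDiffOn hu]
  have hd2 : DifferentiableAt ℝ (fun z ↦ fderiv ℝ (fun z ↦ fderiv ℝ F z (eu m)) z Y) z₀ :=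
    ((contDiffAt_fderiv (hDat z₀ hu)).clm_apply contDiffAt_const).differentiableAt (by simp)
  have h3 : (fun z ↦ pv m (fderiv ℝ (fun z ↦ fderiv ℝ F z (eu m)) z Y)) =ᶠ[𝓝 z₀]
      fun z ↦ -a⁻¹ * fderiv ℝ (fun z ↦ G₂ (F z) (r z) (r z)) z Y := by
    filter_upwards [hU] with z hz using hev2 z hz
  have h4 := DFunLike.congr_fun (h3.fderiv_eq (𝕜 := ℝ)) X
  have hd3 : DifferentiableAt ℝ (fun z ↦ fderiv ℝ (fun z ↦ G₂ (F z) (r z) (r z)) z Y) z₀ :=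
    ((contDiffAt_fderiv ((hB.clm_apply hr').clm_apply hr')).clm_apply
      contDiffAt_const).differentiableAt (by simp)
  rw [fderiv_const_mul hd3, fderiv_pv_comp hd2] at h4
  simp only [smul_apply, hk, smul_eq_mul] at h4
  rw [h4]
  field_simp

lemma hasDerivAt_transversal_deriv (h : IsAxisIsometry G₁ U₁ G₂ U₂ F ρ) {u : ℝ}
    (hu : axis m u ∈ U₁) (hρ : ∀ᶠ t in 𝓝 u, h.slope t = h.slope u)
    (x y : Fin m → ℝ) :
    HasDerivAt (fun u ↦
      transversal G₂ (ρ u) (deriv (transversalDeriv F) u x) (transversalDeriv F u y))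
      (transversal G₂ (ρ u) (deriv (transversalDeriv F) u x) (deriv (transversalDeriv F) u y))
      u := by
  -- Differentiate the right side of `transversal_deriv_eq` along the axis; as the slope is locally
  -- constant, only the third derivative of `F` appears.
  have hF := h.contDiffAt hu
  have h1 := ((((differentiableAt_fderiv (contDiffAt_fderiv hF)).hasFDerivAt.comp_hasDerivAt u
    (hasDerivAt_axis u)).clm_apply (hasDerivAt_const u (ey m x))).clm_apply
      (hasDerivAt_const u (ey m y)))
  have h2 := ((pv m).hasFDerivAt.comp_hasDerivAt u h1).const_mul (-(h.slope u / 2))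
  have h3 := h.third_derivative_eq hu (ey m x) (ey m y)
  rw [h.apply_axis_of_null hu (h.hessian_eu_null hu _) (h.hessian_eu_null hu _),
    fderiv_fderiv_comm hF _ (eu m), fderiv_fderiv_comm hF _ (eu m),
    ← deriv_transversalDeriv_apply hF, ← deriv_transversalDeriv_apply hF] at h3
  have h4 : HasDerivAt (fun t ↦ -(h.slope u / 2)
      * (fderiv ℝ (fderiv ℝ F) (axis m t) (ey m x) (ey m y)).2.1)
      (transversal G₂ (ρ u) (deriv (transversalDeriv F) u x)
      (deriv (transversalDeriv F) u y)) u := by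
    refine h2.congr_deriv ?_
    simp only [map_zero, add_zero, pv_apply]
    linarith
  refine h4.congr_of_eventuallyEq ?_
  filter_upwards [h.eventually_axis_mem hu, hρ] with t ht hs
  rw [h.transversal_deriv_eq ht, hs]

end IsAxisIsometry

end AxisIsometry

/-! ### Isometries between plane waves built from transversal data. -/

section PlaneMap

variable {m : ℕ}

lemma contDiffAt_deriv_of_contDiffAt {V : Type*} [NormedAddCommGroup V] [NormedSpace ℝ V]
    {f : ℝ → V} {u : ℝ} (hf : ContDiffAt ℝ ∞ f u) : ContDiffAt ℝ ∞ (deriv f) u := by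
  have : deriv f = fun t ↦ fderiv ℝ f t 1 := by
    ext1 t
    rw [fderiv_apply_one_eq_deriv]
  rw [this]
  exact (contDiffAt_fderiv hf).clm_apply contDiffAt_const

/-- The plane wave `du dv + c(u)(dy, dy)`. -/
def planeForm (c : ℝ → (Fin m → ℝ) →L[ℝ] (Fin m → ℝ) →L[ℝ] ℝ) (z X Y : Coord m) : ℝ :=
  (X.1 * Y.2.1 + X.2.1 * Y.1) / 2 + c z.1 X.2.2 Y.2.2

/-- Data which define an isometry
`(u, v, y) ↦ (a u + b, a⁻¹ v + Q(u)(y, y), A(u) y)` between plane waves. -/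
structure PlaneTransport (c₁ c₂ : ℝ → (Fin m → ℝ) →L[ℝ] (Fin m → ℝ) →L[ℝ] ℝ) (O : Set ℝ)
    (a b : ℝ) (A : ℝ → (Fin m → ℝ) →L[ℝ] (Fin m → ℝ)) : Prop where
  isOpen : IsOpen O
  scale_ne_zero : a ≠ 0
  contDiffAt_form : ∀ u ∈ O, ContDiffAt ℝ ∞ c₂ (a * u + b)
  form_symm : ∀ u ∈ O, ∀ x y, c₂ (a * u + b) x y = c₂ (a * u + b) y x
  definite : ∀ u ∈ O, ∀ x, c₁ u x x = 0 → x = 0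
  contDiffAt : ∀ u ∈ O, ContDiffAt ℝ ∞ A u
  isometry : ∀ u ∈ O, ∀ x y, c₂ (a * u + b) (A u x) (A u y) = c₁ u x y
  deriv_symm : ∀ u ∈ O, ∀ x y, c₂ (a * u + b) (deriv A u x) (A u y)
    = c₂ (a * u + b) (deriv A u y) (A u x)
  hasDerivAt : ∀ u ∈ O, ∀ x y, HasDerivAt
    (fun u ↦ c₂ (a * u + b) (deriv A u x) (A u y))
    (c₂ (a * u + b) (deriv A u x) (deriv A u y)) u

namespace PlaneTransport

variable {c₁ c₂ : ℝ → (Fin m → ℝ) →L[ℝ] (Fin m → ℝ) →L[ℝ] ℝ} {O : Set ℝ} {a b : ℝ}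
  {A : ℝ → (Fin m → ℝ) →L[ℝ] (Fin m → ℝ)}

/-- The quadratic part of the `v`-component. -/
def quad (_ : PlaneTransport c₁ c₂ O a b A) (u : ℝ) :
    (Fin m → ℝ) →L[ℝ] (Fin m → ℝ) →L[ℝ] ℝ :=
  -a⁻¹ • (c₂ (a * u + b)).bilinearComp (deriv A u) (A u)

lemma quad_apply (h : PlaneTransport c₁ c₂ O a b A) (u : ℝ) (x y : Fin m → ℝ) :
    h.quad u x y = -a⁻¹ * c₂ (a * u + b) (deriv A u x) (A u y) := by
  simp [quad]

lemma contDiffAt_quad (h : PlaneTransport c₁ c₂ O a b A) {u : ℝ} (hu : u ∈ O) :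
    ContDiffAt ℝ ∞ h.quad u := by
  have hs : ContDiffOn ℝ ∞ h.quad O := by
    refine contDiffOn_clm_apply.2 fun x ↦ contDiffOn_clm_apply.2 fun y u hu ↦ ?_
    simp only [h.quad_apply]
    have h1 : ContDiffAt ℝ ∞ (fun u ↦ c₂ (a * u + b)) u :=
      ContDiffAt.comp u (h.contDiffAt_form u hu)
        ((contDiffAt_const.mul contDiffAt_id).add contDiffAt_const)
    exact (contDiffAt_const.mul ((h1.clm_apply
      ((contDiffAt_deriv_of_contDiffAt (h.contDiffAt u hu)).clm_apply contDiffAt_const)).clm_apply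
      ((h.contDiffAt u hu).clm_apply contDiffAt_const))).contDiffWithinAt
  exact hs.contDiffAt (h.isOpen.mem_nhds hu)

lemma quad_symm (h : PlaneTransport c₁ c₂ O a b A) {u : ℝ} (hu : u ∈ O) (x y : Fin m → ℝ) :
    h.quad u x y = h.quad u y x := by
  rw [h.quad_apply, h.quad_apply, h.deriv_symm u hu]

set_option synthInstance.maxHeartbeats 200000 in
lemma deriv_quad (h : PlaneTransport c₁ c₂ O a b A) {u : ℝ} (hu : u ∈ O) (x y : Fin m → ℝ) :
    deriv h.quad u x y = -a⁻¹ * c₂ (a * u + b) (deriv A u x) (deriv A u y) := by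
  have hd : HasDerivAt h.quad (deriv h.quad u) u :=
    ((h.contDiffAt_quad hu).differentiableAt (by simp)).hasDerivAt
  have h1 := (hd.clm_apply (hasDerivAt_const u x)).clm_apply (hasDerivAt_const u y)
  have h2 := (h.hasDerivAt u hu x y).const_mul (-a⁻¹)
  simp only [← h.quad_apply] at h2
  simpa using h1.unique h2

/-- `A u` pulls a form back to a definite one, so it is injective, hence bijective by dimension. -/
lemma exists_equiv (h : PlaneTransport c₁ c₂ O a b A) {u : ℝ} (hu : u ∈ O) :
    ∃ e : (Fin m → ℝ) ≃L[ℝ] (Fin m → ℝ), A u = e := by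
  have hinj : Function.Injective (A u : (Fin m → ℝ) →ₗ[ℝ] (Fin m → ℝ)) := by
    rw [injective_iff_map_eq_zero]
    intro x hx
    refine h.definite u hu x ?_
    rw [← h.isometry u hu]
    have hx' : A u x = 0 := hx
    simp [hx']
  refine ⟨(LinearEquiv.ofInjectiveEndo _ hinj).toContinuousLinearEquiv, ?_⟩
  ext1 x
  rfl

/-- The isometry, composed with translations which move `(·, v₁, y₁)` to `(·, v₂, y₂)`. -/
def toFun (h : PlaneTransport c₁ c₂ O a b A) (p₁ p₂ : ℝ × (Fin m → ℝ)) (z : Coord m) : Coord m :=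
  (a * z.1 + b,
    a⁻¹ * (z.2.1 - p₁.1) + h.quad z.1 (z.2.2 - p₁.2) (z.2.2 - p₁.2) + p₂.1,
    A z.1 (z.2.2 - p₁.2) + p₂.2)

/-- The inverse of `PlaneTransport.toFun`. -/
def invFun (h : PlaneTransport c₁ c₂ O a b A) (p₁ p₂ : ℝ × (Fin m → ℝ)) (w : Coord m) : Coord m :=
  let u := a⁻¹ * (w.1 - b)
  let y := (A u).inverse (w.2.2 - p₂.2)
  (u, a * (w.2.1 - p₂.1 - h.quad u y y) + p₁.1, y + p₁.2)

lemma contDiffAt_toFun (h : PlaneTransport c₁ c₂ O a b A) (p₁ p₂ : ℝ × (Fin m → ℝ))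
    {z : Coord m} (hz : z.1 ∈ O) : ContDiffAt ℝ ∞ (h.toFun p₁ p₂) z := by
  have hA : ContDiffAt ℝ ∞ (fun z : Coord m ↦ A z.1) z :=
    ContDiffAt.comp z (h.contDiffAt _ hz) contDiffAt_fst
  have hQ : ContDiffAt ℝ ∞ (fun z : Coord m ↦ h.quad z.1) z :=
    ContDiffAt.comp z (g := h.quad) (h.contDiffAt_quad hz) contDiffAt_fst
  have hv : ContDiffAt ℝ ∞ (fun z : Coord m ↦ z.2.1 - p₁.1) z :=
    contDiffAt_snd.fst.sub contDiffAt_const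
  have hy : ContDiffAt ℝ ∞ (fun z : Coord m ↦ z.2.2 - p₁.2) z :=
    contDiffAt_snd.snd.sub contDiffAt_const
  exact ((contDiffAt_const.mul contDiffAt_fst).add contDiffAt_const).prodMk
    ((((contDiffAt_const.mul hv).add ((hQ.clm_apply hy).clm_apply hy)).add
      contDiffAt_const).prodMk ((hA.clm_apply hy).add contDiffAt_const))

lemma contDiffAt_invFun (h : PlaneTransport c₁ c₂ O a b A) (p₁ p₂ : ℝ × (Fin m → ℝ))
    {w : Coord m} (hw : a⁻¹ * (w.1 - b) ∈ O) : ContDiffAt ℝ ∞ (h.invFun p₁ p₂) w := by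
  have hu : ContDiffAt ℝ ∞ (fun w : Coord m ↦ a⁻¹ * (w.1 - b)) w :=
    contDiffAt_const.mul (contDiffAt_fst.sub contDiffAt_const)
  obtain ⟨e, he⟩ := h.exists_equiv hw
  have hA : ContDiffAt ℝ ∞ (fun w : Coord m ↦ A (a⁻¹ * (w.1 - b))) w :=
    ContDiffAt.comp w (h.contDiffAt _ hw) hu
  have hB : ContDiffAt ℝ ∞ (fun w : Coord m ↦ (A (a⁻¹ * (w.1 - b))).inverse) w := by
    refine ContDiffAt.comp w (g := ContinuousLinearMap.inverse) ?_ hA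
    rw [he]
    exact contDiffAt_map_inverse e
  have hQ : ContDiffAt ℝ ∞ (fun w : Coord m ↦ h.quad (a⁻¹ * (w.1 - b))) w :=
    ContDiffAt.comp w (g := h.quad) (h.contDiffAt_quad hw) hu
  have hy : ContDiffAt ℝ ∞ (fun w : Coord m ↦
      (A (a⁻¹ * (w.1 - b))).inverse (w.2.2 - p₂.2)) w :=
    hB.clm_apply (contDiffAt_snd.snd.sub contDiffAt_const)
  exact hu.prodMk (((contDiffAt_const.mul (((contDiffAt_snd.fst.sub contDiffAt_const).sub
    ((hQ.clm_apply hy).clm_apply hy)))).add contDiffAt_const).prodMk (hy.add contDiffAt_const))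

/-- The isometry as a partial homeomorphism between slabs. -/
def toOpenPartialHomeomorph (h : PlaneTransport c₁ c₂ O a b A) (p₁ p₂ : ℝ × (Fin m → ℝ)) :
    OpenPartialHomeomorph (Coord m) (Coord m) where
  toFun := h.toFun p₁ p₂
  invFun := h.invFun p₁ p₂
  source := slab m O
  target := {w | a⁻¹ * (w.1 - b) ∈ O}
  map_source' z hz := by
    have ha := h.scale_ne_zero
    have hz' : z.1 ∈ O := hz
    simpa [toFun, ha] using hz'
  map_target' w hw := hw
  left_inv' z hz := by
    have ha := h.scale_ne_zero
    obtain ⟨e, he⟩ := h.exists_equiv hz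
    have hu : a⁻¹ * ((h.toFun p₁ p₂ z).1 - b) = z.1 := by simp [toFun, ha]
    unfold invFun
    simp only [hu]
    simp [he, toFun, ha]
  right_inv' w hw := by
    have ha := h.scale_ne_zero
    obtain ⟨e, he⟩ := h.exists_equiv hw
    simp [invFun, he, toFun, ha]
  open_source := h.isOpen.preimage continuous_fst
  open_target := h.isOpen.preimage (by fun_prop)
  continuousOn_toFun z hz := (h.contDiffAt_toFun p₁ p₂ hz).continuousAt.continuousWithinAt
  continuousOn_invFun w hw := (h.contDiffAt_invFun p₁ p₂ hw).continuousAt.continuousWithinAt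

set_option synthInstance.maxHeartbeats 200000 in
lemma fderiv_toFun (h : PlaneTransport c₁ c₂ O a b A) (p₁ p₂ : ℝ × (Fin m → ℝ))
    {z : Coord m} (hz : z.1 ∈ O) (X : Coord m) :
    fderiv ℝ (h.toFun p₁ p₂) z X = (a * X.1,
      a⁻¹ * X.2.1 + X.1 * deriv h.quad z.1 (z.2.2 - p₁.2) (z.2.2 - p₁.2)
        + 2 * h.quad z.1 (z.2.2 - p₁.2) X.2.2,
      X.1 • deriv A z.1 (z.2.2 - p₁.2) + A z.1 X.2.2) := by
  have hfst : HasFDerivAt (fun z : Coord m ↦ z.1) (ContinuousLinearMap.fst ℝ ℝ _) z :=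
    hasFDerivAt_fst
  have hA := HasFDerivAt.comp z (g := A)
    ((h.contDiffAt _ hz).differentiableAt (by simp)).hasFDerivAt hfst
  have hQ := HasFDerivAt.comp z (g := h.quad)
    ((h.contDiffAt_quad hz).differentiableAt (by simp)).hasFDerivAt hfst
  have hv : HasFDerivAt (fun z : Coord m ↦ z.2.1 - p₁.1) (pv m) z :=
    (pv m).hasFDerivAt.sub_const _
  have hy : HasFDerivAt (fun z : Coord m ↦ z.2.2 - p₁.2) (py m) z :=
    (py m).hasFDerivAt.sub_const _
  have key := ((hfst.const_mul a).add_const b).prodMk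
    ((((hv.const_mul a⁻¹).add ((hQ.clm_apply hy).clm_apply hy)).add_const p₂.1).prodMk
      ((hA.clm_apply hy).add_const p₂.2))
  have key' : HasFDerivAt (h.toFun p₁ p₂) _ z := key
  rw [key'.fderiv]
  simp [h.quad_symm hz X.2.2, fderiv_eq_smul_deriv]
  constructor
  · ring
  · module

/-- With `Q = -a⁻¹ c₂(A' ·, A ·)`, the `du dy` terms `2 a Q(y, dy) + 2 c₂(A' y, A dy)` cancel
because `Q` is symmetric, and the `du²` term `a Q'(y, y) + c₂(A' y, A' y)` is zero by the formula
for `Q'`. What remains is `du dv + c₁(dy, dy)`. -/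
lemma isLocalIsometry (h : PlaneTransport c₁ c₂ O a b A) (p₁ p₂ : ℝ × (Fin m → ℝ))
    {I₁ I₂ : Set ℝ} {h₁ h₂ : Coord m → Coord m → Coord m → ℝ} (hO : O ⊆ I₁)
    (hO' : ∀ w, a⁻¹ * (w - b) ∈ O → w ∈ I₂)
    (hh₁ : ∀ z ∈ slab m I₁, h₁ z = planeForm c₁ z) (hh₂ : ∀ z ∈ slab m I₂, h₂ z = planeForm c₂ z) :
    IsLocalIsometry (slab m I₁) h₁ (slab m I₂) h₂ (h.toOpenPartialHomeomorph p₁ p₂) where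
  source_subset z hz := hO hz
  target_subset w hw := hO' _ hw
  contDiffOn z hz := (h.contDiffAt_toFun p₁ p₂ hz).contDiffWithinAt
  contDiffOn_symm w hw := (h.contDiffAt_invFun p₁ p₂ hw).contDiffWithinAt
  metric z hz X Y := by
    have ha := h.scale_ne_zero
    have hz' : z.1 ∈ O := hz
    have h2 : h.toFun p₁ p₂ z ∈ slab m I₂ := hO' _ (by simpa [toFun, ha] using hz')
    change h₂ (h.toFun p₁ p₂ z) (fderiv ℝ (h.toFun p₁ p₂) z X) (fderiv ℝ (h.toFun p₁ p₂) z Y) = _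
    rw [hh₁ z (hO hz), hh₂ _ h2, h.fderiv_toFun p₁ p₂ hz', h.fderiv_toFun p₁ p₂ hz']
    simp only [planeForm]
    change _ + c₂ (a * z.1 + b) _ _ = _
    simp only [map_add, map_smul, add_apply, smul_apply, smul_eq_mul, h.isometry z.1 hz',
      h.deriv_quad hz', h.quad_apply, h.form_symm z.1 hz' (A z.1 X.2.2)]
    field_simp
    ring

end PlaneTransport

end PlaneMap

/-! ### The flow of isometries read in adapted coordinates. -/

section AdaptedCoordinates

variable {m : ℕ} {E : Type*} [NormedAddCommGroup E] [NormedSpace ℝ E]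
  {M : Type*} [TopologicalSpace M] [ChartedSpace E M] [IsManifold 𝓘(ℝ, E) ∞ M]
  {g : LorentzMetric E M} {γ : ℝ → M} {I : Set ℝ}

omit [IsManifold 𝓘(ℝ, E) ∞ M] in
/-- A local diffeomorphism has a smooth local inverse between open sets. -/
lemma IsLocalDiffeoOn.exists_inverse {V : Type*} [NormedAddCommGroup V] [NormedSpace ℝ V]
    {Φ : V → M} {U : Set V} (hΦ : IsLocalDiffeoOn E Φ U) {z : V} (hz : z ∈ U) :
    ∃ (Ψ : M → V) (S : Set V) (T : Set M), IsOpen S ∧ IsOpen T ∧ z ∈ S ∧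
      (∀ x ∈ S, Φ x ∈ T ∧ Ψ (Φ x) = x) ∧ (∀ y ∈ T, Ψ y ∈ S ∧ Φ (Ψ y) = y) ∧
      ∀ y ∈ T, ContMDiffAt 𝓘(ℝ, E) 𝓘(ℝ, V) ∞ Ψ y := by
  obtain ⟨f, hzf, hf⟩ := hΦ ⟨z, hz⟩
  refine ⟨f.symm, f.source, f.target, f.open_source, f.open_target, hzf, fun x hx ↦ ?_,
    fun y hy ↦ ?_, fun y hy ↦ ?_⟩
  · rw [hf hx]
    exact ⟨f.map_source hx, f.left_inv hx⟩
  · have hy' : f.symm y ∈ f.source := f.map_target hy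
    rw [hf hy']
    exact ⟨hy', f.right_inv hy⟩
  · exact f.contMDiffOn_invFun.contMDiffAt (f.open_target.mem_nhds hy)

omit [IsManifold 𝓘(ℝ, E) ∞ M] in
lemma IsLocalDiffeoOn.contMDiffAt {V : Type*} [NormedAddCommGroup V] [NormedSpace ℝ V]
    {Φ : V → M} {U : Set V} (hΦ : IsLocalDiffeoOn E Φ U) {z : V} (hz : z ∈ U) :
    ContMDiffAt 𝓘(ℝ, V) 𝓘(ℝ, E) ∞ Φ z :=
  IsLocalDiffeomorphAt.contMDiffAt (hΦ ⟨z, hz⟩)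

namespace AdaptedCoordinates

/-- The metric in adapted coordinates. -/
def form (A : AdaptedCoordinates m g γ I) : Coord m → Coord m →L[ℝ] Coord m →L[ℝ] ℝ :=
  pullbackForm g A.Φ

lemma form_self (A : AdaptedCoordinates m g γ I) {z : Coord m} (hz : z ∈ A.U) (X : Coord m) :
    A.form z X X = X.1 * X.2.1 + A.α z * X.2.1 ^ 2 + (∑ i, A.β z i * X.2.2 i) * X.2.1
      + ∑ i, ∑ j, A.C z i j * X.2.2 i * X.2.2 j := A.metric z hz X

lemma form_symm (A : AdaptedCoordinates m g γ I) (z X Y : Coord m) :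
    A.form z X Y = A.form z Y X := pullback_symm g A.Φ z X Y

/-- The coordinate expression of the metric is given only on the diagonal; polarization recovers the
bilinear form. -/
lemma form_polar (A : AdaptedCoordinates m g γ I) (z X Y : Coord m) :
    A.form z X Y = (A.form z (X + Y) (X + Y) - A.form z X X - A.form z Y Y) / 2 := by
  simp only [map_add, add_apply, A.form_symm z Y X]
  ring

lemma isAdaptedForm (A : AdaptedCoordinates m g γ I) : IsAdaptedForm A.form A.U where
  isOpen := A.isOpen_U
  contDiffOn := contDiffOn_pullbackForm g fun _ hz ↦ A.localDiffeo.contMDiffAt hz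
  symm z _ X Y := A.form_symm z X Y
  apply_eu z hz Y := by
    rw [A.form_polar, A.form_self hz, A.form_self hz, A.form_self hz]
    simp [eu]
    ring

lemma transversal_form (A : AdaptedCoordinates m g γ I) {u : ℝ} (hu : u ∈ I)
    (x y : Fin m → ℝ) :
    transversal A.form u x y = ∑ i, ∑ j, A.C (u, 0, 0) i j * x i * y j := by
  have hz := A.axis_mem u hu
  have hC : ∀ i j, A.C (u, 0, 0) i j = A.C (u, 0, 0) j i := fun i j ↦ by
    simpa using (A.posDef _ hz).isHermitian.apply j i
  rw [transversal_apply, A.form_polar]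
  unfold axis
  rw [A.form_self hz, A.form_self hz, A.form_self hz]
  have hswap : ∑ i, ∑ j, A.C (u, 0, 0) i j * y i * x j
      = ∑ i, ∑ j, A.C (u, 0, 0) i j * x i * y j := by
    rw [Finset.sum_comm]
    refine Finset.sum_congr rfl fun i _ ↦ Finset.sum_congr rfl fun j _ ↦ ?_
    rw [hC j i]
    ring
  simp only [ey_apply, Prod.mk_add_mk, Pi.add_apply, mul_add, add_mul, Finset.sum_add_distrib,
    hswap]
  ring

lemma transversal_definite (A : AdaptedCoordinates m g γ I) {u : ℝ} (hu : u ∈ I)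
    (x : Fin m → ℝ) (hx : transversal A.form u x x = 0) : x = 0 := by
  by_contra h0
  have h := (A.posDef _ (A.axis_mem u hu)).dotProduct_mulVec_pos h0
  rw [A.transversal_form hu] at hx
  refine h.ne' (Eq.trans ?_ hx)
  simp only [dotProduct, Matrix.mulVec, Finset.mul_sum, star_trivial]
  refine Finset.sum_congr rfl fun i _ ↦ Finset.sum_congr rfl fun j _ ↦ ?_
  ring

end AdaptedCoordinates

lemma IsAdaptedForm.mono {G : Coord m → Coord m →L[ℝ] Coord m →L[ℝ] ℝ} {U W : Set (Coord m)}
    (h : IsAdaptedForm G U) (hW : IsOpen W) (hWU : W ⊆ U) : IsAdaptedForm G W where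
  isOpen := hW
  contDiffOn := h.contDiffOn.mono hWU
  symm z hz := h.symm z (hWU hz)
  apply_eu z hz := h.apply_eu z (hWU hz)

section Transport

variable {φ : ℝ → M → M} (hφ : IsOneParameterIsometryGroup g φ) {t : ℝ} {I₁ I₂ O : Set ℝ}
  (A₁ : AdaptedCoordinates m g γ I₁) (A₂ : AdaptedCoordinates m g γ I₂) {ρ : ℝ → ℝ}

-- `F` is `Φ₂⁻¹ ∘ φ_t ∘ Φ₁`, with the branch of `Φ₂⁻¹` near the axis point over `ρ(u)`. It exists
-- only near one axis point, since the coordinate maps need not be injective.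
include hφ in
lemma exists_axisIsometry (hO : IsOpen O) (hO₁ : O ⊆ I₁) (hρ₂ : MapsTo ρ O I₂)
    (hρ : ContinuousOn ρ O) (hγ : ∀ u ∈ O, φ t (γ u) = γ (ρ u)) {u : ℝ} (hu : u ∈ O) :
    ∃ (F : Coord m → Coord m) (W : Set (Coord m)), axis m u ∈ W ∧
      IsAxisIsometry A₁.form W A₂.form A₂.U F ρ ∧
      (∀ z ∈ W, z.1 ∈ O) ∧ ∀ z ∈ W, A₂.Φ (F z) = φ t (A₁.Φ z) := by
  obtain ⟨Ψ, S, T, hS, hT, hzS, hST, hTS, hΨ⟩ :=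
    A₂.localDiffeo.exists_inverse (A₂.axis_mem _ (hρ₂ hu))
  have hax : ∀ u ∈ O, φ t (A₁.Φ (axis m u)) = A₂.Φ (axis m (ρ u)) := fun u hu ↦ by
    rw [axis, axis, A₁.axis_eq u (hO₁ hu), A₂.axis_eq _ (hρ₂ hu), hγ u hu]
  set F : Coord m → Coord m := fun z ↦ Ψ (φ t (A₁.Φ z)) with hF
  have hU₁ : axis m u ∈ A₁.U := A₁.axis_mem u (hO₁ hu)
  have hφΦ : ∀ z ∈ A₁.U, ContMDiffAt 𝓘(ℝ, Coord m) 𝓘(ℝ, E) ∞ (fun z ↦ φ t (A₁.Φ z)) z :=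
    fun z hz ↦ (hφ.contMDiff_apply t).contMDiffAt.comp z (A₁.localDiffeo.contMDiffAt hz)
  have hT0 : φ t (A₁.Φ (axis m u)) ∈ T := by
    rw [hax u hu]
    exact (hST _ hzS).1
  have hFsm : ∀ z ∈ A₁.U, φ t (A₁.Φ z) ∈ T → ContDiffAt ℝ ∞ F z := fun z hz hzT ↦
    ((hΨ _ hzT).comp z (hφΦ z hz)).contDiffAt
  have hF0 : F (axis m u) = axis m (ρ u) := by
    rw [hF]
    simp only [hax u hu]
    exact (hST _ hzS).2
  -- The last condition keeps the target axis point in the domain of the chosen branch, so that `Ψ`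
  -- returns that point and not another preimage under `A₂.Φ`.
  have hev : ∀ᶠ z in 𝓝 (axis m u), z ∈ A₁.U ∧ φ t (A₁.Φ z) ∈ T ∧ F z ∈ A₂.U ∧ z.1 ∈ O ∧
      axis m (ρ z.1) ∈ S := by
    refine (A₁.isOpen_U.eventually_mem hU₁).and (((hφΦ _ hU₁).continuousAt.eventually
      (hT.mem_nhds hT0)).and (((hFsm _ hU₁ hT0).continuousAt.eventually
      (A₂.isOpen_U.mem_nhds ?_)).and
      ((continuousAt_fst.eventually (hO.mem_nhds hu)).and ?_)))
    · rw [hF0]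
      exact A₂.axis_mem _ (hρ₂ hu)
    · have hc : ContinuousAt (fun z : Coord m ↦ axis m (ρ z.1)) (axis m u) :=
        continuous_axis.continuousAt.comp
          (ContinuousAt.comp (f := Prod.fst) (g := ρ) (x := axis m u)
            (hρ.continuousAt (hO.mem_nhds hu)) continuousAt_fst)
      exact hc.eventually (hS.mem_nhds hzS)
  obtain ⟨W, hW, hWo, huW⟩ := mem_nhds_iff.1 hev
  have hFΦ : ∀ z ∈ W, A₂.Φ (F z) = φ t (A₁.Φ z) := fun z hz ↦ (hTS _ (hW hz).2.1).2
  have hFW : ∀ z ∈ W, ContDiffAt ℝ ∞ F z := fun z hz ↦ hFsm z (hW hz).1 (hW hz).2.1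
  refine ⟨F, W, huW, ⟨A₁.isAdaptedForm.mono hWo fun z hz ↦ (hW hz).1, A₂.isAdaptedForm,
    fun z hz ↦ (hFW z hz).contDiffWithinAt, fun z hz ↦ (hW hz).2.2.1, fun z hz X Y ↦ ?_,
    fun u hu ↦ ?_⟩, fun z hz ↦ (hW hz).2.2.2.1, hFΦ⟩
  · have h1 := pullback_comp g (A₂.localDiffeo.contMDiffAt (hW hz).2.2.1 |>.mdifferentiableAt
      (by simp)) ((hFW z hz).differentiableAt (by simp)) X Y
    have h2 := hφ.pullback_comp t
      ((A₁.localDiffeo.contMDiffAt (hW hz).1).mdifferentiableAt (by simp)) X Y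
    have h3 : A₂.Φ ∘ F =ᶠ[𝓝 z] φ t ∘ A₁.Φ := by
      filter_upwards [hWo.mem_nhds hz] with z' hz' using hFΦ z' hz'
    rw [pullback_congr g h3, h2] at h1
    exact h1.symm
  · rw [hF]
    simp only [hax u (hW hu).2.2.2.1]
    exact (hST _ (hW hu).2.2.2.2).2

include hφ in
/-- The flow transports the transversal metric of one portion of the geodesic to that of another
one, along an affine map of the parameters. -/
lemma exists_planeTransport (hO : IsOpen O) (hO' : IsPreconnected O) (hne : O.Nonempty)
    (hO₁ : O ⊆ I₁) (hρ₂ : MapsTo ρ O I₂) (hρ : ContinuousOn ρ O)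
    (hγ : ∀ u ∈ O, φ t (γ u) = γ (ρ u)) :
    ∃ (a b : ℝ) (A : ℝ → (Fin m → ℝ) →L[ℝ] (Fin m → ℝ)), (∀ u ∈ O, ρ u = a * u + b) ∧
      PlaneTransport (transversal A₁.form) (transversal A₂.form) O a b A := by
  classical
  have hex := fun (u : ℝ) (hu : u ∈ O) ↦ exists_axisIsometry hφ A₁ A₂ hO hO₁ hρ₂ hρ hγ hu
  choose! F W huW hFW hWO hFΦ using hex
  -- Each `u` has its own local isometry `F u`. Only their derivatives on the axis are glued; `hAev`
  -- below shows that neighbouring choices agree.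
  set A : ℝ → (Fin m → ℝ) →L[ℝ] (Fin m → ℝ) := fun u ↦ transversalDeriv (F u) u with hA
  have hnear : ∀ u ∈ O, ∀ᶠ t in 𝓝 u, t ∈ O ∧ axis m t ∈ W u := fun u hu ↦
    (hO.eventually_mem hu).and ((hFW u hu).eventually_axis_mem (huW u hu))
  have hρ' : ∀ u (hu : u ∈ O), ∀ t, axis m t ∈ W u → HasDerivAt ρ ((hFW u hu).slope t) t :=
    fun u hu t ht ↦ ((hFW u hu).fderiv_eu ht).1
  have hslope : ∀ u (hu : u ∈ O), deriv ρ =ᶠ[𝓝 u] (hFW u hu).slope := fun u hu ↦ by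
    filter_upwards [hnear u hu] with t ht using (hρ' u hu t ht.2).deriv
  have hdd : ∀ u ∈ O, HasDerivAt (deriv ρ) 0 u := fun u hu ↦
    ((hFW u hu).hasDerivAt_slope (huW u hu)).congr_of_eventuallyEq (hslope u hu)
  -- Connectedness of `O` turns the vanishing of `ρ''` into a single affine formula.
  obtain ⟨a, ha⟩ := hO.exists_is_const_of_deriv_eq_zero hO'
    (fun u hu ↦ (hdd u hu).differentiableAt.differentiableWithinAt) fun u hu ↦ (hdd u hu).deriv
  have hρd : ∀ u ∈ O, HasDerivAt ρ a u := fun u hu ↦ by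
    rw [← ha u hu]
    exact (hρ' u hu u (huW u hu)).differentiableAt.hasDerivAt
  have hlin : ∀ u ∈ O, HasDerivAt (fun u ↦ ρ u - a * u) 0 u := fun u hu ↦ by
    simpa using (hρd u hu).fun_sub ((hasDerivAt_id u).const_mul a)
  obtain ⟨b, hb⟩ := hO.exists_is_const_of_deriv_eq_zero hO'
    (fun u hu ↦ (hlin u hu).differentiableAt.differentiableWithinAt) fun u hu ↦ (hlin u hu).deriv
  have hab : ∀ u ∈ O, ρ u = a * u + b := fun u hu ↦ by linarith [hb u hu]
  have hAev : ∀ u ∈ O, A =ᶠ[𝓝 u] transversalDeriv (F u) := fun u hu ↦ by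
    filter_upwards [hnear u hu] with t ht
    obtain ⟨Ψ, S, T, hS, -, hzS, hST, -, -⟩ :=
      A₂.localDiffeo.exists_inverse (A₂.axis_mem _ (hρ₂ ht.1))
    have hloc : ∀ v ∈ O, axis m t ∈ W v → ∀ᶠ z in 𝓝 (axis m t), F v z ∈ S ∧
        A₂.Φ (F v z) = φ _ (A₁.Φ z) := fun v hv htv ↦ by
      have h1 := (hFW v hv).contDiffAt htv
      refine (h1.continuousAt.eventually (hS.mem_nhds ?_)).and ?_
      · rw [(hFW v hv).map_axis t htv]
        exact hzS
      · filter_upwards [(hFW v hv).source.isOpen.mem_nhds htv] with z hz using hFΦ v hv z hz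
    -- Both maps lift `φ_t ∘ Φ₁` through `A₂.Φ` into the set `S`, on which `A₂.Φ` is injective.
    have heq : F t =ᶠ[𝓝 (axis m t)] F u := by
      filter_upwards [hloc t ht.1 (huW t ht.1), hloc u hu ht.2] with z h1 h2
      rw [← (hST _ h1.1).2, ← (hST _ h2.1).2, h1.2, h2.2]
    simp only [hA, transversalDeriv, heq.fderiv_eq]
  have hAdev : ∀ u ∈ O, deriv A =ᶠ[𝓝 u] deriv (transversalDeriv (F u)) := fun u hu ↦
    (hAev u hu).deriv
  refine ⟨a, b, A, hab, hO, ?_, fun u hu ↦ ?_, fun u hu x y ↦ A₂.form_symm _ _ _, fun u hu ↦ ?_,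
    fun u hu ↦ ?_, fun u hu x y ↦ ?_, fun u hu x y ↦ ?_, fun u hu x y ↦ ?_⟩
  · obtain ⟨u, hu⟩ := hne
    rw [← ha u hu, (hslope u hu).self_of_nhds]
    exact (hFW u hu).slope_ne_zero (huW u hu)
  · rw [← hab u hu]
    exact A₂.isAdaptedForm.contDiffAt_transversal (A₂.axis_mem _ (hρ₂ hu))
  · exact A₁.transversal_definite (hO₁ hu)
  · exact (contDiffAt_transversalDeriv ((hFW u hu).contDiffAt (huW u hu))).congr_of_eventuallyEq
      (hAev u hu)
  · rw [← hab u hu]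
    exact (hFW u hu).transversal_eq (huW u hu) x y
  · rw [← hab u hu, (hAdev u hu).self_of_nhds]
    exact (hFW u hu).transversal_deriv_symm (huW u hu) x y
  · rw [← hab u hu, (hAdev u hu).self_of_nhds]
    have hconst : ∀ᶠ t in 𝓝 u, (hFW u hu).slope t = (hFW u hu).slope u := by
      filter_upwards [hnear u hu] with t ht
      rw [← (hρ' u hu t ht.2).deriv, ← (hρ' u hu u (huW u hu)).deriv, ha t ht.1, ha u hu]
    refine ((hFW u hu).hasDerivAt_transversal_deriv (huW u hu) hconst x y).congr_of_eventuallyEq ?_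
    filter_upwards [hnear u hu, hAev u hu, hAdev u hu] with t ht h1 h2
    rw [h1, h2, hab t ht.1]

end Transport

end AdaptedCoordinates

/-! ### Taylor expansion, along the axis, of a Killing field tangent to the axis. -/

section AxisKilling

set_option synthInstance.maxHeartbeats 200000

variable {m : ℕ}

/-- A Killing vector field of an adapted form which is tangent to the axis. -/
structure IsAxisKilling (G : Coord m → Coord m →L[ℝ] Coord m →L[ℝ] ℝ) (U : Set (Coord m))
    (Z : Coord m → Coord m) (f : ℝ → ℝ) : Prop where
  form : IsAdaptedForm G U
  contDiffOn : ContDiffOn ℝ ∞ Z U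
  killing : ∀ z ∈ U, ∀ X Y, fderiv ℝ G z (Z z) X Y + G z (fderiv ℝ Z z X) Y
    + G z X (fderiv ℝ Z z Y) = 0
  map_axis : ∀ u, axis m u ∈ U → Z (axis m u) = axis m (f u)

lemma IsAdaptedForm.fderiv_apply_eu {G : Coord m → Coord m →L[ℝ] Coord m →L[ℝ] ℝ}
    {U : Set (Coord m)} (hG : IsAdaptedForm G U) {z : Coord m} (hz : z ∈ U) (V Y : Coord m) :
    fderiv ℝ G z V (eu m) Y = 0 := by
  have h1 := (((hG.contDiffAt hz).differentiableAt (by simp)).hasFDerivAt.clm_apply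
    (hasFDerivAt_const (eu m) z)).clm_apply (hasFDerivAt_const Y z)
  have h2 : HasFDerivAt (fun z ↦ G z (eu m) Y) (0 : Coord m →L[ℝ] ℝ) z := by
    refine (hasFDerivAt_const (Y.2.1 / 2) z).congr_of_eventuallyEq ?_
    filter_upwards [hG.isOpen.mem_nhds hz] with z' hz' using hG.apply_eu z' hz' Y
  simpa using DFunLike.congr_fun (h1.unique h2) V

namespace IsAxisKilling

variable {G : Coord m → Coord m →L[ℝ] Coord m →L[ℝ] ℝ} {U : Set (Coord m)}
  {Z : Coord m → Coord m} {f : ℝ → ℝ}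

lemma contDiffAt (h : IsAxisKilling G U Z f) {z : Coord m} (hz : z ∈ U) : ContDiffAt ℝ ∞ Z z :=
  h.contDiffOn.contDiffAt (h.form.isOpen.mem_nhds hz)

lemma eventually_axis_mem (h : IsAxisKilling G U Z f) {u : ℝ} (hu : axis m u ∈ U) :
    ∀ᶠ t in 𝓝 u, axis m t ∈ U :=
  (h.form.isOpen.preimage continuous_axis).mem_nhds hu

lemma contDiffAt_speed (h : IsAxisKilling G U Z f) {u : ℝ} (hu : axis m u ∈ U) :
    ContDiffAt ℝ ∞ f u := by
  have h1 : ContDiffAt ℝ ∞ (fun u ↦ (Z (axis m u)).1) u :=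
    (ContDiffAt.comp u (h.contDiffAt hu) contDiff_axis.contDiffAt).fst
  refine h1.congr_of_eventuallyEq ?_
  filter_upwards [h.eventually_axis_mem hu] with t ht
  rw [h.map_axis t ht, axis]

lemma fderiv_eu (h : IsAxisKilling G U Z f) {u : ℝ} (hu : axis m u ∈ U) :
    fderiv ℝ Z (axis m u) (eu m) = deriv f u • eu m := by
  have h1 : HasDerivAt (fun u ↦ Z (axis m u)) (fderiv ℝ Z (axis m u) (eu m)) u :=
    ((h.contDiffAt hu).differentiableAt (by simp)).hasFDerivAt.comp_hasDerivAt u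
      (hasDerivAt_axis u)
  have h2 : HasDerivAt (fun u ↦ Z (axis m u)) (deriv f u • eu m) u := by
    refine ((hasDerivAt_axis (m := m) (f u)).scomp u
      ((h.contDiffAt_speed hu).differentiableAt (by simp)).hasDerivAt).congr_of_eventuallyEq ?_
    filter_upwards [h.eventually_axis_mem hu] with t ht using h.map_axis t ht
  exact h1.unique h2

lemma apply_fderiv_eu (h : IsAxisKilling G U Z f) {z : Coord m} (hz : z ∈ U) (Y : Coord m) :
    G z (fderiv ℝ Z z (eu m)) Y + (fderiv ℝ Z z Y).2.1 / 2 = 0 := by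
  have h1 := h.killing z hz (eu m) Y
  rwa [h.form.fderiv_apply_eu hz, h.form.apply_eu z hz, zero_add] at h1

lemma fderiv_eu_null (h : IsAxisKilling G U Z f) {z : Coord m} (hz : z ∈ U) :
    (fderiv ℝ Z z (eu m)).2.1 = 0 := by
  have h1 := h.apply_fderiv_eu hz (eu m)
  rw [h.form.apply_eu' hz] at h1
  linarith

lemma fderiv_axis (h : IsAxisKilling G U Z f) {u : ℝ} (hu : axis m u ∈ U) (Y : Coord m) :
    (fderiv ℝ Z (axis m u) Y).2.1 = -(deriv f u * Y.2.1) := by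
  have h1 := h.apply_fderiv_eu hu Y
  rw [h.fderiv_eu hu, map_smul, smul_apply, h.form.apply_eu _ hu, smul_eq_mul] at h1
  linarith

lemma hessian_eu_null (h : IsAxisKilling G U Z f) {z : Coord m} (hz : z ∈ U) (X : Coord m) :
    (fderiv ℝ (fderiv ℝ Z) z X (eu m)).2.1 = 0 := by
  have hd : DifferentiableAt ℝ (fun z ↦ fderiv ℝ Z z (eu m)) z :=
    ((contDiffAt_fderiv (h.contDiffAt hz)).clm_apply contDiffAt_const).differentiableAt (by simp)
  rw [← fderiv_fderiv_apply (h.contDiffAt hz), ← fderiv_pv_comp hd]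
  have hev : (fun z ↦ pv m (fderiv ℝ Z z (eu m))) =ᶠ[𝓝 z] fun _ ↦ (0 : ℝ) := by
    filter_upwards [h.form.isOpen.mem_nhds hz] with z' hz' using h.fderiv_eu_null hz'
  rw [hev.fderiv_eq]
  simp

/-- On the axis `(DZ ∂_v)_v = -f'`, and its `u`-derivative is `(D²Z(∂_v, ∂_u))_v = 0`. So `f` is
locally affine, the infinitesimal form of the affinity of `ρ`. -/
lemma hasDerivAt_deriv_speed (h : IsAxisKilling G U Z f) {u : ℝ} (hu : axis m u ∈ U) :
    HasDerivAt (deriv f) 0 u := by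
  have h1 := ((pv m).hasFDerivAt.comp_hasDerivAt u
    (hasDerivAt_fderiv_axis (h.contDiffAt hu) (ev m))).neg
  rw [fderiv_fderiv_comm (h.contDiffAt hu), pv_apply, h.hessian_eu_null hu, neg_zero] at h1
  refine h1.congr_of_eventuallyEq ?_
  filter_upwards [h.eventually_axis_mem hu] with t ht
  have := h.fderiv_axis ht (ev m)
  simp [this]
  simp [ev]

/-- As `G(∂_u, ·)` has constant coefficients, the Killing equation with `∂_u` is `G(DZ ∂_u, Y) =
-(DZ Y)_v / 2`. Subtracting `f' ∂_u`, with `f'` frozen, from `DZ ∂_u` leaves a field that vanishes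
at the axis point, so no derivative of `G` survives. -/
lemma hessian_eq (h : IsAxisKilling G U Z f) {u : ℝ} (hu : axis m u ∈ U) (X Y : Coord m) :
    G (axis m u) (fderiv ℝ (fderiv ℝ Z) (axis m u) X (eu m)) Y
      = -(fderiv ℝ (fderiv ℝ Z) (axis m u) X Y).2.1 / 2 := by
  set z₀ := axis m u
  set r : Coord m → Coord m := fun z ↦ fderiv ℝ Z z (eu m) - deriv f u • eu m with hr
  have hr0 : r z₀ = 0 := by simp [hr, z₀, h.fderiv_eu hu]
  have hZ := h.contDiffAt hu
  have hrd : DifferentiableAt ℝ r z₀ :=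
    (((contDiffAt_fderiv hZ).clm_apply contDiffAt_const).sub contDiffAt_const).differentiableAt
      (by simp)
  have hB : DifferentiableAt ℝ G z₀ := (h.form.contDiffAt hu).differentiableAt (by simp)
  have hY : DifferentiableAt ℝ (fun _ : Coord m ↦ Y) z₀ := differentiableAt_const _
  have hw : DifferentiableAt ℝ (fun z ↦ fderiv ℝ Z z Y) z₀ :=
    ((contDiffAt_fderiv hZ).clm_apply contDiffAt_const).differentiableAt (by simp)
  have hev : (fun z ↦ G z (r z) Y) =ᶠ[𝓝 z₀]
      fun z ↦ -(1 / 2) * pv m (fderiv ℝ Z z Y) - deriv f u * Y.2.1 / 2 := by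
    filter_upwards [h.form.isOpen.mem_nhds hu] with z hz
    have := h.apply_fderiv_eu hz Y
    simp only [hr, map_sub, map_smul, sub_apply, smul_apply, h.form.apply_eu _ hz, smul_eq_mul,
      pv_apply]
    linarith
  have h1 := DFunLike.congr_fun (hev.fderiv_eq (𝕜 := ℝ)) X
  rw [fderiv_bilinear_of_eq_zero hB hrd hY hr0, hr, fderiv_sub_const, fderiv_sub_const,
    fderiv_const_mul, smul_apply, fderiv_pv_comp hw, fderiv_fderiv_apply hZ,
    fderiv_fderiv_apply hZ, smul_eq_mul] at h1
  · rw [h1]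
    ring
  · exact ((pv m).hasFDerivAt.comp z₀ hw.hasFDerivAt).differentiableAt

lemma transversal_deriv_eq (h : IsAxisKilling G U Z f) {u : ℝ} (hu : axis m u ∈ U)
    (x y : Fin m → ℝ) :
    transversal G u (deriv (transversalDeriv Z) u x) y
      = -(1 / 2) * (fderiv ℝ (fderiv ℝ Z) (axis m u) (ey m x) (ey m y)).2.1 := by
  have hZ := h.contDiffAt hu
  have h1 := h.hessian_eq hu (ey m x) (ey m y)
  rw [h.form.apply_of_null hu (h.hessian_eu_null hu _) rfl, fderiv_fderiv_comm hZ (ey m x) (eu m),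
    ← deriv_transversalDeriv_apply hZ] at h1
  rw [transversal_apply]
  change G (axis m u) _ (ey m y) = _ at h1
  rw [h1]
  ring

lemma transversal_deriv_symm (h : IsAxisKilling G U Z f) {u : ℝ} (hu : axis m u ∈ U)
    (x y : Fin m → ℝ) :
    transversal G u (deriv (transversalDeriv Z) u x) y
      = transversal G u (deriv (transversalDeriv Z) u y) x := by
  rw [h.transversal_deriv_eq hu, h.transversal_deriv_eq hu, fderiv_fderiv_comm (h.contDiffAt hu)]

/-- The Killing equation on the pair `(∂_u, ∂_u)` says that `Z_v` does not depend on `u` locally,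
throughout `U`; derivatives commute. Unlike for isometries, no quadratic term appears. -/
lemma third_derivative_eq (h : IsAxisKilling G U Z f) {u : ℝ} (hu : axis m u ∈ U)
    (X Y : Coord m) :
    (fderiv ℝ (fderiv ℝ (fderiv ℝ Z)) (axis m u) (eu m) X Y).2.1 = 0 := by
  have hd : ∀ z ∈ U, ContDiffAt ℝ ∞ (fun z ↦ fderiv ℝ Z z (eu m)) z := fun z hz ↦
    (contDiffAt_fderiv (h.contDiffAt hz)).clm_apply contDiffAt_const
  have hd2 : DifferentiableAt ℝ (fun z ↦ fderiv ℝ (fun z ↦ fderiv ℝ Z z (eu m)) z Y) (axis m u) :=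
    ((contDiffAt_fderiv (hd _ hu)).clm_apply contDiffAt_const).differentiableAt (by simp)
  rw [fderiv_fderiv_fderiv_rotate h.form.isOpen h.contDiffOn hu, ← fderiv_pv_comp hd2]
  have hev : (fun z ↦ pv m (fderiv ℝ (fun z ↦ fderiv ℝ Z z (eu m)) z Y)) =ᶠ[𝓝 (axis m u)]
      fun _ ↦ (0 : ℝ) := by
    filter_upwards [h.form.isOpen.mem_nhds hu] with z hz
    rw [fderiv_fderiv_apply (h.contDiffAt hz), fderiv_fderiv_comm (h.contDiffAt hz),
      fderiv_fderiv_comm (h.contDiffAt hz), pv_apply, h.hessian_eu_null hz]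
  rw [hev.fderiv_eq]
  simp

lemma hasDerivAt_transversal_deriv (h : IsAxisKilling G U Z f) {u : ℝ} (hu : axis m u ∈ U)
    (x y : Fin m → ℝ) :
    HasDerivAt (fun u ↦ transversal G u (deriv (transversalDeriv Z) u x) y) 0 u := by
  have h1 := ((((differentiableAt_fderiv (contDiffAt_fderiv
    (h.contDiffAt hu))).hasFDerivAt.comp_hasDerivAt u (hasDerivAt_axis u)).clm_apply
      (hasDerivAt_const u (ey m x))).clm_apply (hasDerivAt_const u (ey m y)))
  have h2 := ((pv m).hasFDerivAt.comp_hasDerivAt u h1).const_mul (-(1 / 2))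
  have h4 : HasDerivAt (fun t ↦ -(1 / 2)
      * (fderiv ℝ (fderiv ℝ Z) (axis m t) (ey m x) (ey m y)).2.1) 0 u := by
    refine h2.congr_deriv ?_
    simp [h.third_derivative_eq hu]
  refine h4.congr_of_eventuallyEq ?_
  filter_upwards [h.eventually_axis_mem hu] with t ht
  rw [h.transversal_deriv_eq ht]

lemma transversal_killing (h : IsAxisKilling G U Z f) {u : ℝ} (hu : axis m u ∈ U)
    (x y : Fin m → ℝ) :
    f u * deriv (transversal G) u x y + transversal G u (transversalDeriv Z u x) y
      + transversal G u x (transversalDeriv Z u y) = 0 := by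
  have h1 := h.killing _ hu (ey m x) (ey m y)
  have hn : ∀ y, (fderiv ℝ Z (axis m u) (ey m y)).2.1 = 0 := fun y ↦ by
    rw [h.fderiv_axis hu]
    simp [ey_apply]
  rw [h.form.apply_of_null hu (hn x) rfl, h.form.apply_of_null hu rfl (hn y), h.map_axis u hu] at h1
  have ht : HasDerivAt (transversal G) (deriv (transversal G) u) u :=
    ((h.form.contDiffAt_transversal hu).differentiableAt (by simp)).hasDerivAt
  have h2 := (ht.clm_apply (hasDerivAt_const u x)).clm_apply (hasDerivAt_const u y)
  have h3 := ((((h.form.contDiffAt hu).differentiableAt (by simp)).hasFDerivAt.comp_hasDerivAt u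
    (hasDerivAt_axis u)).clm_apply (hasDerivAt_const u (ey m x))).clm_apply
      (hasDerivAt_const u (ey m y))
  have h4 := h2.unique h3
  simp only [map_zero, add_zero] at h4
  have h5 : axis m (f u) = f u • eu m := by simp [axis, eu]
  rw [h5, map_smul, smul_apply, smul_apply, smul_eq_mul, ← h4] at h1
  exact h1

end IsAxisKilling

end AxisKilling

/-! ### Killing fields of plane waves built from transversal data. -/

section PlaneKilling

set_option synthInstance.maxHeartbeats 200000

variable {m : ℕ}

/-- Data which define a Killing vector field
`f(u) ∂_u + (-f'(u) v + q(u)(y, y)) ∂_v + L(u) y ∂_y` of a plane wave. -/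
structure PlaneKilling (c : ℝ → (Fin m → ℝ) →L[ℝ] (Fin m → ℝ) →L[ℝ] ℝ) (I : Set ℝ)
    (f : ℝ → ℝ) (L : ℝ → (Fin m → ℝ) →L[ℝ] (Fin m → ℝ)) : Prop where
  isOpen : IsOpen I
  contDiffAt_form : ∀ u ∈ I, ContDiffAt ℝ ∞ c u
  contDiffAt_speed : ∀ u ∈ I, ContDiffAt ℝ ∞ f u
  contDiffAt : ∀ u ∈ I, ContDiffAt ℝ ∞ L u
  form_symm : ∀ u ∈ I, ∀ x y, c u x y = c u y x
  deriv_speed : ∀ u ∈ I, HasDerivAt (deriv f) 0 u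
  deriv_symm : ∀ u ∈ I, ∀ x y, c u (deriv L u x) y = c u (deriv L u y) x
  hasDerivAt : ∀ u ∈ I, ∀ x y, HasDerivAt (fun u ↦ c u (deriv L u x) y) 0 u
  killing : ∀ u ∈ I, ∀ x y, f u * deriv c u x y + c u (L u x) y + c u x (L u y) = 0

namespace PlaneKilling

variable {c : ℝ → (Fin m → ℝ) →L[ℝ] (Fin m → ℝ) →L[ℝ] ℝ} {I : Set ℝ}
    {f : ℝ → ℝ} {L : ℝ → (Fin m → ℝ) →L[ℝ] (Fin m → ℝ)}

/-- The quadratic part of the `v`-component. -/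
def quad (_ : PlaneKilling c I f L) (u : ℝ) : (Fin m → ℝ) →L[ℝ] (Fin m → ℝ) →L[ℝ] ℝ :=
  -(c u).comp (deriv L u)

lemma quad_apply (h : PlaneKilling c I f L) (u : ℝ) (x y : Fin m → ℝ) :
    h.quad u x y = -c u (deriv L u x) y := rfl

lemma contDiffAt_quad (h : PlaneKilling c I f L) {u : ℝ} (hu : u ∈ I) :
    ContDiffAt ℝ ∞ h.quad u :=
  ((h.contDiffAt_form u hu).clm_comp (contDiffAt_deriv_of_contDiffAt (h.contDiffAt u hu))).neg

lemma hasFDerivAt_quad (h : PlaneKilling c I f L) {u : ℝ} (hu : u ∈ I) :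
    HasFDerivAt h.quad (0 : ℝ →L[ℝ] (Fin m → ℝ) →L[ℝ] (Fin m → ℝ) →L[ℝ] ℝ) u := by
  have hd : HasDerivAt h.quad (deriv h.quad u) u :=
    ((h.contDiffAt_quad hu).differentiableAt (by simp)).hasDerivAt
  have h0 : deriv h.quad u = 0 := by
    ext1 x
    ext1 y
    have h1 := (hd.clm_apply (hasDerivAt_const u x)).clm_apply (hasDerivAt_const u y)
    have h2 := (h.hasDerivAt u hu x y).neg
    have h3 := h1.unique h2
    simpa using h3
  rw [h0] at hd
  simpa using hd.hasFDerivAt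

/-- The vector field. -/
def field (h : PlaneKilling c I f L) (z : Coord m) : Coord m :=
  (f z.1, -(deriv f z.1) * z.2.1 + h.quad z.1 z.2.2 z.2.2, L z.1 z.2.2)

lemma contDiffAt_field (h : PlaneKilling c I f L) {z : Coord m} (hz : z.1 ∈ I) :
    ContDiffAt ℝ ∞ h.field z := by
  have hf : ContDiffAt ℝ ∞ (fun z : Coord m ↦ f z.1) z :=
    ContDiffAt.comp z (g := f) (h.contDiffAt_speed _ hz) contDiffAt_fst
  have hf' : ContDiffAt ℝ ∞ (fun z : Coord m ↦ deriv f z.1) z :=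
    ContDiffAt.comp z (g := deriv f)
      (contDiffAt_deriv_of_contDiffAt (h.contDiffAt_speed _ hz)) contDiffAt_fst
  have hQ : ContDiffAt ℝ ∞ (fun z : Coord m ↦ h.quad z.1) z :=
    ContDiffAt.comp z (g := h.quad) (h.contDiffAt_quad hz) contDiffAt_fst
  have hL : ContDiffAt ℝ ∞ (fun z : Coord m ↦ L z.1) z :=
    ContDiffAt.comp z (g := L) (h.contDiffAt _ hz) contDiffAt_fst
  have hv : ContDiffAt ℝ ∞ (fun z : Coord m ↦ z.2.1) z := contDiffAt_snd.fst
  have hy : ContDiffAt ℝ ∞ (fun z : Coord m ↦ z.2.2) z := contDiffAt_snd.snd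
  exact hf.prodMk (((hf'.neg.mul hv).add ((hQ.clm_apply hy).clm_apply hy)).prodMk
    (hL.clm_apply hy))

lemma fderiv_field (h : PlaneKilling c I f L) {z : Coord m} (hz : z.1 ∈ I) (X : Coord m) :
    fderiv ℝ h.field z X = (deriv f z.1 * X.1,
      -(deriv f z.1) * X.2.1 + 2 * h.quad z.1 z.2.2 X.2.2,
      X.1 • deriv L z.1 z.2.2 + L z.1 X.2.2) := by
  have hfst : HasFDerivAt (fun z : Coord m ↦ z.1) (ContinuousLinearMap.fst ℝ ℝ _) z :=
    hasFDerivAt_fst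
  have hf := HasFDerivAt.comp z (g := f)
    ((h.contDiffAt_speed _ hz).differentiableAt (by simp)).hasFDerivAt hfst
  have hf' := HasFDerivAt.comp z (g := deriv f) (h.deriv_speed _ hz).hasFDerivAt hfst
  have hL := HasFDerivAt.comp z (g := L)
    ((h.contDiffAt _ hz).differentiableAt (by simp)).hasFDerivAt hfst
  have hQ := HasFDerivAt.comp z (g := h.quad) (h.hasFDerivAt_quad hz) hfst
  have hv : HasFDerivAt (fun z : Coord m ↦ z.2.1) (pv m) z := (pv m).hasFDerivAt
  have hy : HasFDerivAt (fun z : Coord m ↦ z.2.2) (py m) z := (py m).hasFDerivAt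
  have key : HasFDerivAt h.field _ z := hf.prodMk
    (((hf'.neg.mul hv).add ((hQ.clm_apply hy).clm_apply hy)).prodMk (hL.clm_apply hy))
  have hs : h.quad z.1 X.2.2 z.2.2 = h.quad z.1 z.2.2 X.2.2 := by
    rw [h.quad_apply, h.quad_apply, h.deriv_symm _ hz]
  rw [key.fderiv]
  simp [hs, fderiv_eq_smul_deriv]
  refine ⟨by ring, by ring, by module⟩

end PlaneKilling

/-- A plane wave metric only depends on `u`. -/
lemma fderiv_planeForm {c : ℝ → (Fin m → ℝ) →L[ℝ] (Fin m → ℝ) →L[ℝ] ℝ} {z : Coord m}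
    (hc : DifferentiableAt ℝ c z.1) (V X Y : Coord m) :
    fderiv ℝ (fun z ↦ planeForm c z X Y) z V = V.1 * deriv c z.1 X.2.2 Y.2.2 := by
  have hfst : HasFDerivAt (fun z : Coord m ↦ z.1) (ContinuousLinearMap.fst ℝ ℝ _) z :=
    hasFDerivAt_fst
  have h1 := HasFDerivAt.comp z (g := c) hc.hasDerivAt.hasFDerivAt hfst
  have key : HasFDerivAt (fun z ↦ planeForm c z X Y) _ z :=
    ((h1.clm_apply (hasFDerivAt_const X.2.2 z)).clm_apply (hasFDerivAt_const Y.2.2 z)).const_add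
      ((X.1 * Y.2.1 + X.2.1 * Y.1) / 2)
  rw [key.fderiv]
  simp

/-- Multiples of a Killing vector field of a plane wave plus translations of `v` and `y` are
Killing vector fields. -/
lemma PlaneKilling.isKilling {c : ℝ → (Fin m → ℝ) →L[ℝ] (Fin m → ℝ) →L[ℝ] ℝ} {I : Set ℝ}
    {f : ℝ → ℝ} {L : ℝ → (Fin m → ℝ) →L[ℝ] (Fin m → ℝ)} (h : PlaneKilling c I f L)
    (k : ℝ) (w : ℝ × (Fin m → ℝ)) :
    IsKilling (slab m I) (planeForm c) (fun z ↦ k • h.field z + (0, w)) where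
  contDiffOn z hz := (((h.contDiffAt_field hz).const_smul k).add
    contDiffAt_const).contDiffWithinAt
  killing z hz X Y := by
    have hz' : z.1 ∈ I := hz
    have hd := (h.contDiffAt_field hz').differentiableAt (by simp)
    have h1 := h.killing _ hz' X.2.2 Y.2.2
    rw [fderiv_planeForm ((h.contDiffAt_form _ hz').differentiableAt (by simp)),
      fderiv_add_const, fderiv_fun_const_smul hd]
    simp only [smul_apply, h.fderiv_field hz', planeForm, Prod.smul_mk, Prod.fst_add,
      field, h.quad_apply, h.form_symm _ hz' X.2.2 (deriv L z.1 z.2.2),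
      map_add, map_smul, add_apply, smul_eq_mul]
    -- The terms with `f'` cancel within `du dv`, and those with `L'` cancel against the quadratic
    -- part of the `v`-component; only the transversal Killing equation is left.
    linear_combination k * h1

end PlaneKilling

/-! ### The generator of the flow as a Killing field in adapted coordinates. -/

section KillingField

set_option synthInstance.maxHeartbeats 200000

variable {m : ℕ} {E : Type*} [NormedAddCommGroup E] [NormedSpace ℝ E]
  {M : Type*} [TopologicalSpace M] [ChartedSpace E M] [IsManifold 𝓘(ℝ, E) ∞ M]
  {g : LorentzMetric E M} {γ : ℝ → M} {J : Set ℝ} {φ : ℝ → M → M} {p : M} {s : ℝ → ℝ}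

variable (E) in
/-- The derivative of a map from a vector space to the manifold, as a linear map into `E`. -/
def derivMap {V : Type*} [NormedAddCommGroup V] [NormedSpace ℝ V] (Φ : V → M) (z : V) : V →L[ℝ] E :=
  mfderiv 𝓘(ℝ, V) 𝓘(ℝ, E) Φ z

variable (E) in
/-- The vector field which generates the flow `φ`. -/
def generator (φ : ℝ → M → M) (x : M) : E := derivMap E (fun t ↦ φ t x) 0 (1 : ℝ)

omit [IsManifold 𝓘(ℝ, E) ∞ M] in
lemma derivMap_comp {V W : Type*} [NormedAddCommGroup V] [NormedSpace ℝ V]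
    [NormedAddCommGroup W] [NormedSpace ℝ W] {Φ : V → M} {F : W → V} {z : W}
    (hΦ : MDifferentiableAt 𝓘(ℝ, V) 𝓘(ℝ, E) Φ (F z)) (hF : DifferentiableAt ℝ F z) (X : W) :
    derivMap E (fun w ↦ Φ (F w)) z X = derivMap E Φ (F z) (fderiv ℝ F z X) := by
  unfold derivMap
  have := mfderiv_comp z hΦ hF.mdifferentiableAt
  rw [mfderiv_eq_fderiv] at this
  exact DFunLike.congr_fun this X

omit [IsManifold 𝓘(ℝ, E) ∞ M] in
lemma derivMap_congr {V : Type*} [NormedAddCommGroup V] [NormedSpace ℝ V] {Φ Ψ : V → M} {z : V}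
    (h : Φ =ᶠ[𝓝 z] Ψ) : derivMap E Φ z = derivMap E Ψ z := h.mfderiv_eq

omit [IsManifold 𝓘(ℝ, E) ∞ M] in
lemma IsLocalDiffeoOn.derivMap_injective {V : Type*} [NormedAddCommGroup V] [NormedSpace ℝ V]
    {Φ : V → M} {U : Set V} (hΦ : IsLocalDiffeoOn E Φ U) {z : V} (hz : z ∈ U) :
    Function.Injective (derivMap E Φ z) := by
  have h : IsLocalDiffeomorphAt 𝓘(ℝ, V) 𝓘(ℝ, E) ∞ Φ z := hΦ ⟨z, hz⟩
  have h1 := h.mfderivToContinuousLinearEquiv_coe (by simp)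
  have h2 := (h.mfderivToContinuousLinearEquiv (by simp)).injective
  intro X Y hXY
  apply h2
  have h3 : ∀ X, h.mfderivToContinuousLinearEquiv (by simp) X = derivMap E Φ z X := fun X ↦
    DFunLike.congr_fun h1 X
  exact (h3 X).trans (hXY.trans (h3 Y).symm)

/-- The velocity of a curve along an orbit. -/
lemma IsHomogeneousAlong.velocity_eq (hom : IsHomogeneousAlong g γ J φ p s) (hJ : IsOpen J)
    {u : ℝ} (hu : u ∈ J) : derivMap E γ u 1 = deriv s u • generator E φ (γ u) := by
  have hs : DifferentiableAt ℝ s u :=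
    (hom.contDiffOn.contDiffAt (hJ.mem_nhds hu)).differentiableAt (by simp)
  have horb : ∀ t, MDifferentiableAt 𝓘(ℝ, ℝ) 𝓘(ℝ, E) (fun t ↦ φ t p) t := fun t ↦
    (hom.group.contMDiff_orbit p).mdifferentiable (by simp) t
  have h1 : derivMap E γ u = derivMap E (fun t ↦ φ (s t) p) u := derivMap_congr (by
    filter_upwards [hJ.mem_nhds hu] with t ht using hom.orbit t ht)
  have h2 : (fun t ↦ φ t (γ u)) = fun t ↦ φ (t + s u) p := by
    funext t
    rw [hom.orbit u hu, hom.group.add]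
  have h3 : ∀ x y : ℝ, x = y →
      derivMap E (fun t ↦ φ t p) x (1 : ℝ) = derivMap E (fun t ↦ φ t p) y (1 : ℝ) := by
    rintro x y rfl
    rfl
  have hd : HasDerivAt (fun t ↦ t + s u) 1 0 := (hasDerivAt_id (0 : ℝ)).add_const _
  rw [h1, derivMap_comp (Φ := fun t ↦ φ t p) (horb _) hs, generator, h2,
    derivMap_comp (Φ := fun t ↦ φ t p) (F := fun t ↦ t + s u) (horb _) hd.differentiableAt,
    fderiv_apply_one_eq_deriv, fderiv_apply_one_eq_deriv, hd.deriv, h3 _ _ (zero_add (s u)),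
    ← map_smul, smul_eq_mul, mul_one]

lemma IsHomogeneousAlong.deriv_ne_zero (hom : IsHomogeneousAlong g γ J φ p s)
    (hγ : IsNullGeodesicOn g γ J) {u : ℝ} (hu : u ∈ J) : deriv s u ≠ 0 := by
  intro h0
  refine hγ.velocity_ne_zero u hu ?_
  have h := hom.velocity_eq hγ.isOpen hu
  rw [h0, zero_smul] at h
  exact h

section Flow

variable {I : Set ℝ} (A : AdaptedCoordinates m g γ I)

/-- The generator of the flow in adapted coordinates. -/
def AdaptedCoordinates.generator (φ : ℝ → M → M) (z : Coord m) : Coord m :=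
  Function.invFun (derivMap E A.Φ z) (PenroseLimit.generator E φ (A.Φ z))

lemma AdaptedCoordinates.generator_eq {z : Coord m} (hz : z ∈ A.U) {X : Coord m}
    (hX : derivMap E A.Φ z X = PenroseLimit.generator E φ (A.Φ z)) : A.generator φ z = X := by
  rw [AdaptedCoordinates.generator, ← hX]
  exact Function.leftInverse_invFun (A.localDiffeo.derivMap_injective hz) X

/-- The local flow in adapted coordinates. -/
lemma AdaptedCoordinates.exists_local_flow (hφ : IsOneParameterIsometryGroup g φ) {z₀ : Coord m}
    (hz₀ : z₀ ∈ A.U) :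
    ∃ Θ : ℝ × Coord m → Coord m, ContDiffAt ℝ ∞ Θ (0, z₀) ∧
      (∀ᶠ z in 𝓝 z₀, Θ (0, z) = z) ∧
      (∀ᶠ q in 𝓝 ((0 : ℝ), z₀), q.2 ∈ A.U ∧ ContDiffAt ℝ ∞ Θ q ∧ Θ q ∈ A.U ∧
        A.Φ (Θ q) = φ q.1 (A.Φ q.2)) := by
  obtain ⟨Ψ, S, T, hS, hT, hzS, hST, hTS, hΨ⟩ := A.localDiffeo.exists_inverse hz₀
  have hflow : ∀ q : ℝ × Coord m, q.2 ∈ A.U →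
      ContMDiffAt 𝓘(ℝ, ℝ × Coord m) 𝓘(ℝ, E) ∞ (fun q ↦ φ q.1 (A.Φ q.2)) q := by
    intro q hq
    have h1 : ContMDiffAt 𝓘(ℝ, ℝ × Coord m) 𝓘(ℝ, ℝ) ∞ (fun q : ℝ × Coord m ↦ q.1) q :=
      contDiffAt_fst.contMDiffAt
    have h2 : ContMDiffAt 𝓘(ℝ, ℝ × Coord m) 𝓘(ℝ, Coord m) ∞ (fun q : ℝ × Coord m ↦ q.2) q :=
      contDiffAt_snd.contMDiffAt
    exact hφ.contMDiff.contMDiffAt.comp q (h1.prodMk ((A.localDiffeo.contMDiffAt hq).comp q h2))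
  have hsm : ∀ q : ℝ × Coord m, q.2 ∈ A.U → φ q.1 (A.Φ q.2) ∈ T →
      ContDiffAt ℝ ∞ (fun q : ℝ × Coord m ↦ Ψ (φ q.1 (A.Φ q.2))) q := fun q hq hqT ↦
    ((hΨ _ hqT).comp q (hflow q hq)).contDiffAt
  have hT₀ : φ (0 : ℝ) (A.Φ z₀) ∈ T := by
    rw [hφ.zero]
    exact (hST _ hzS).1
  have h0 : ∀ z ∈ S, Ψ (φ 0 (A.Φ z)) = z := fun z hz ↦ by rw [hφ.zero, (hST _ hz).2]
  refine ⟨fun q ↦ Ψ (φ q.1 (A.Φ q.2)), hsm _ hz₀ hT₀, ?_, ?_⟩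
  · filter_upwards [hS.mem_nhds hzS] with z hz using h0 z hz
  · have e1 : ∀ᶠ q in 𝓝 ((0 : ℝ), z₀), q.2 ∈ A.U :=
      continuousAt_snd.eventually (A.isOpen_U.mem_nhds hz₀)
    have e2 : ∀ᶠ q in 𝓝 ((0 : ℝ), z₀), φ q.1 (A.Φ q.2) ∈ T :=
      (hflow (0, z₀) hz₀).continuousAt.eventually (hT.mem_nhds hT₀)
    have e3 : ∀ᶠ q in 𝓝 ((0 : ℝ), z₀), Ψ (φ q.1 (A.Φ q.2)) ∈ A.U := by
      refine (hsm (0, z₀) hz₀ hT₀).continuousAt.eventually (A.isOpen_U.mem_nhds ?_)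
      simp only [h0 z₀ hzS]
      exact hz₀
    filter_upwards [e1, e2, e3] with q h1 h2 h3 using ⟨h1, hsm q h1 h2, h3, (hTS _ h2).2⟩

lemma eventually_slice {P : ℝ × Coord m → Prop} {z₀ : Coord m}
    (h : ∀ᶠ q in 𝓝 ((0 : ℝ), z₀), P q) : ∀ᶠ z in 𝓝 z₀, ∀ᶠ q in 𝓝 ((0 : ℝ), z), P q := by
  have hc : ContinuousAt (fun z : Coord m ↦ ((0 : ℝ), z)) z₀ := by fun_prop
  exact hc.eventually h.eventually_nhds

/-- A flow of isometries satisfies the Killing equation at time zero. -/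
lemma killing_of_flow {V : Type*} [NormedAddCommGroup V] [NormedSpace ℝ V]
    {G : V → V →L[ℝ] V →L[ℝ] ℝ} {Θ : ℝ × V → V} {z : V} (hG : DifferentiableAt ℝ G z)
    (hΘ : ContDiffAt ℝ ∞ Θ (0, z)) (h0 : Θ (0, z) = z)
    (hid : ∀ X, fderiv ℝ Θ (0, z) (0, X) = X) {X Y : V}
    (hiso : (fun q : ℝ × V ↦ G (Θ q) (fderiv ℝ Θ q (0, X)) (fderiv ℝ Θ q (0, Y)))
      =ᶠ[𝓝 (0, z)] fun q ↦ G q.2 X Y) :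
    fderiv ℝ G z (fderiv ℝ Θ (0, z) (1, 0)) X Y
      + G z (fderiv ℝ (fderiv ℝ Θ) (0, z) (1, 0) (0, X)) Y
      + G z X (fderiv ℝ (fderiv ℝ Θ) (0, z) (1, 0) (0, Y)) = 0 := by
  have hG' : HasFDerivAt G (fderiv ℝ G z) (Θ (0, z)) := by
    rw [h0]
    exact hG.hasFDerivAt
  have hw : ∀ X, HasFDerivAt (fun q : ℝ × V ↦ fderiv ℝ Θ q (0, X)) _ (0, z) := fun X ↦
    (differentiableAt_fderiv hΘ).hasFDerivAt.clm_apply (hasFDerivAt_const (0, X) (0, z))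
  have hB := HasFDerivAt.comp (g := G) (0, z) hG' (hΘ.differentiableAt (by simp)).hasFDerivAt
  have hL := (hB.clm_apply (hw X)).clm_apply (hw Y)
  have hsnd : HasFDerivAt (Prod.snd : ℝ × V → V) (ContinuousLinearMap.snd ℝ ℝ V) (0, z) :=
    hasFDerivAt_snd
  have hB' : HasFDerivAt (fun q : ℝ × V ↦ G q.2) ((fderiv ℝ G z).comp _) ((0 : ℝ), z) :=
    HasFDerivAt.comp (g := G) ((0 : ℝ), z) hG.hasFDerivAt hsnd
  have hR := (hB'.clm_apply (hasFDerivAt_const X _)).clm_apply (hasFDerivAt_const Y _)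
  have hfin := DFunLike.congr_fun ((hL.congr_of_eventuallyEq hiso.symm).unique hR) (1, 0)
  simp [hid, h0] at hfin
  linarith

/-- Near `z₀` the generator is `∂_t Θ` at `t = 0` for the local flow `Θ`, hence smooth, and its
derivative is a mixed second derivative of `Θ`. The Killing equation is the `t`-derivative of `Θ_t^*
G = G`. -/
lemma AdaptedCoordinates.generator_local (hφ : IsOneParameterIsometryGroup g φ) {z₀ : Coord m}
    (hz₀ : z₀ ∈ A.U) : ContDiffAt ℝ ∞ (A.generator φ) z₀ ∧
      ∀ X Y, fderiv ℝ A.form z₀ (A.generator φ z₀) X Y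
        + A.form z₀ (fderiv ℝ (A.generator φ) z₀ X) Y
        + A.form z₀ X (fderiv ℝ (A.generator φ) z₀ Y) = 0 := by
  obtain ⟨Θ, hΘ, hΘ0, hΘn⟩ := A.exists_local_flow hφ hz₀
  have hgen : A.generator φ =ᶠ[𝓝 z₀] fun z ↦ fderiv ℝ Θ (0, z) (1, 0) := by
    filter_upwards [eventually_slice hΘn, hΘ0] with z hz hz0
    obtain ⟨hzU, hd, -, -⟩ := hz.self_of_nhds
    have hd' : DifferentiableAt ℝ Θ (0, z) := hd.differentiableAt (by simp)
    refine A.generator_eq hzU ?_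
    have hcurve : HasFDerivAt (fun t : ℝ ↦ (t, z)) (ContinuousLinearMap.inl ℝ ℝ (Coord m)) 0 :=
      hasFDerivAt_prodMk_left 0 z
    have hΘc : HasFDerivAt (fun t : ℝ ↦ Θ (t, z))
        ((fderiv ℝ Θ (0, z)).comp (ContinuousLinearMap.inl ℝ ℝ (Coord m))) 0 :=
      hd'.hasFDerivAt.comp (0 : ℝ) hcurve
    have h1 : derivMap E (fun t ↦ φ t (A.Φ z)) 0 = derivMap E (fun t ↦ A.Φ (Θ (t, z))) 0 := by
      refine derivMap_congr ?_
      have hc : ContinuousAt (fun t : ℝ ↦ (t, z)) 0 := by fun_prop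
      filter_upwards [hc.eventually hz] with t ht using ht.2.2.2.symm
    have hΦ : MDifferentiableAt 𝓘(ℝ, Coord m) 𝓘(ℝ, E) A.Φ (Θ (0, z)) := by
      rw [hz0]
      exact (A.localDiffeo.contMDiffAt hzU).mdifferentiableAt (by simp)
    rw [PenroseLimit.generator, h1, derivMap_comp (F := fun t ↦ Θ (t, z)) hΦ hΘc.differentiableAt,
      hΘc.fderiv, hz0]
    simp
  have hfd : ContDiffAt ℝ ∞ (fderiv ℝ Θ) (0, z₀) := contDiffAt_fderiv hΘ
  have hinc : HasFDerivAt (fun z : Coord m ↦ ((0 : ℝ), z))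
      (ContinuousLinearMap.inr ℝ ℝ (Coord m)) z₀ := hasFDerivAt_prodMk_right 0 z₀
  have hsm : ContDiffAt ℝ ∞ (fun z : Coord m ↦ fderiv ℝ Θ (0, z) (1, 0)) z₀ :=
    (ContDiffAt.comp z₀ (f := fun z : Coord m ↦ ((0 : ℝ), z)) hfd
      (contDiffAt_const.prodMk contDiffAt_id)).clm_apply contDiffAt_const
  refine ⟨hsm.congr_of_eventuallyEq hgen, fun X Y ↦ ?_⟩
  have hdX : ∀ X, fderiv ℝ (A.generator φ) z₀ X
      = fderiv ℝ (fderiv ℝ Θ) (0, z₀) (1, 0) (0, X) := fun X ↦ by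
    have h1 := ((hfd.differentiableAt (by simp)).hasFDerivAt.comp z₀ hinc).clm_apply
      (hasFDerivAt_const ((1 : ℝ), (0 : Coord m)) z₀)
    have h1' : HasFDerivAt (fun z : Coord m ↦ fderiv ℝ Θ (0, z) (1, 0)) _ z₀ := h1
    rw [hgen.fderiv_eq, h1'.fderiv, fderiv_fderiv_comm hΘ]
    simp
  have hid : ∀ X, fderiv ℝ Θ (0, z₀) (0, X) = X := fun X ↦ by
    have h1 : HasFDerivAt (fun z : Coord m ↦ Θ (0, z)) _ z₀ :=
      (hΘ.differentiableAt (by simp)).hasFDerivAt.comp z₀ hinc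
    have h2 : HasFDerivAt (fun z : Coord m ↦ Θ (0, z)) (ContinuousLinearMap.id ℝ (Coord m)) z₀ :=
      (hasFDerivAt_id z₀).congr_of_eventuallyEq hΘ0
    simpa using DFunLike.congr_fun (h1.unique h2) X
  have hiso : (fun q : ℝ × Coord m ↦ A.form (Θ q) (fderiv ℝ Θ q (0, X)) (fderiv ℝ Θ q (0, Y)))
      =ᶠ[𝓝 (0, z₀)] fun q ↦ A.form q.2 X Y := by
    filter_upwards [hΘn.eventually_nhds] with q hq
    obtain ⟨hqU, hqd, hqU', -⟩ := hq.self_of_nhds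
    have hinc' : HasFDerivAt (fun z : Coord m ↦ (q.1, z))
        (ContinuousLinearMap.inr ℝ ℝ (Coord m)) q.2 := hasFDerivAt_prodMk_right q.1 q.2
    have hΘq : HasFDerivAt (fun z : Coord m ↦ Θ (q.1, z))
        ((fderiv ℝ Θ q).comp (ContinuousLinearMap.inr ℝ ℝ (Coord m))) q.2 :=
      HasFDerivAt.comp (g := Θ) q.2 (hqd.differentiableAt (by simp)).hasFDerivAt hinc'
    have hΦq : MDifferentiableAt 𝓘(ℝ, Coord m) 𝓘(ℝ, E) A.Φ (Θ (q.1, q.2)) :=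
      (A.localDiffeo.contMDiffAt hqU').mdifferentiableAt (by simp)
    have h1 := pullback_comp g (F := fun z ↦ Θ (q.1, z)) hΦq hΘq.differentiableAt X Y
    have h2 := hφ.pullback_comp q.1
      ((A.localDiffeo.contMDiffAt hqU).mdifferentiableAt (by simp)) X Y
    have h3 : A.Φ ∘ (fun z ↦ Θ (q.1, z)) =ᶠ[𝓝 q.2] φ q.1 ∘ A.Φ := by
      have hc : ContinuousAt (fun z : Coord m ↦ (q.1, z)) q.2 := by fun_prop
      filter_upwards [hc.eventually hq] with z hz using hz.2.2.2
    rw [pullback_congr g h3, h2, hΘq.fderiv] at h1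
    simpa [AdaptedCoordinates.form, pullbackForm_apply] using h1.symm
  rw [hdX, hdX, hgen.self_of_nhds]
  exact killing_of_flow ((A.isAdaptedForm.contDiffAt hz₀).differentiableAt (by simp)) hΘ
    hΘ0.self_of_nhds hid hiso

end Flow

/-- From `γ' = s' · generator`, the generator on the axis is `(1 / s') ∂_u`. The domain is cut down
to the slab because the axis is known to map to `γ` only over `I`. -/
lemma AdaptedCoordinates.isAxisKilling {I : Set ℝ} (A : AdaptedCoordinates m g γ I)
    (hom : IsHomogeneousAlong g γ J φ p s) (hγ : IsNullGeodesicOn g γ J) (hI : I ⊆ J) :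
    IsAxisKilling A.form (A.U ∩ slab m I) (A.generator φ) (fun u ↦ (deriv s u)⁻¹) where
  form := A.isAdaptedForm.mono (A.isOpen_U.inter (A.isOpen_interval.preimage continuous_fst))
    inter_subset_left
  contDiffOn z hz := (A.generator_local hom.group hz.1).1.contDiffWithinAt
  killing z hz := (A.generator_local hom.group hz.1).2
  map_axis u hu := by
    have huI : u ∈ I := hu.2
    refine A.generator_eq hu.1 ?_
    have h1 := hom.velocity_eq hγ.isOpen (hI huI)
    have h2 : derivMap E γ u = derivMap E (fun t ↦ A.Φ (axis m t)) u := derivMap_congr (by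
      filter_upwards [A.isOpen_interval.mem_nhds huI] with t ht using (A.axis_eq t ht).symm)
    have h3 : A.Φ (axis m u) = γ u := A.axis_eq u huI
    rw [h2, derivMap_comp ((A.localDiffeo.contMDiffAt hu.1).mdifferentiableAt (by simp))
      (hasDerivAt_axis u).differentiableAt, fderiv_apply_one_eq_deriv,
      (hasDerivAt_axis u).deriv] at h1
    have h4 : axis m (deriv s u)⁻¹ = (deriv s u)⁻¹ • eu m := by simp [axis, eu]
    rw [h4, map_smul, h1, smul_smul, inv_mul_cancel₀ (hom.deriv_ne_zero hγ (hI huI)), one_smul, h3]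

/-- The Penrose limit inherits a Killing vector field. -/
lemma AdaptedCoordinates.planeKilling {I : Set ℝ} (A : AdaptedCoordinates m g γ I)
    (hom : IsHomogeneousAlong g γ J φ p s) (hγ : IsNullGeodesicOn g γ J) (hI : I ⊆ J) :
    PlaneKilling (transversal A.form) I (fun u ↦ (deriv s u)⁻¹)
      (transversalDeriv (A.generator φ)) := by
  have h := A.isAxisKilling hom hγ hI
  have hmem : ∀ u ∈ I, axis m u ∈ A.U ∩ slab m I := fun u hu ↦ ⟨A.axis_mem u hu, hu⟩
  exact ⟨A.isOpen_interval, fun u hu ↦ h.form.contDiffAt_transversal (hmem u hu),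
    fun u hu ↦ h.contDiffAt_speed (hmem u hu),
    fun u hu ↦ contDiffAt_transversalDeriv (h.contDiffAt (hmem u hu)),
    fun u hu x y ↦ A.form_symm _ _ _, fun u hu ↦ h.hasDerivAt_deriv_speed (hmem u hu),
    fun u hu ↦ h.transversal_deriv_symm (hmem u hu),
    fun u hu ↦ h.hasDerivAt_transversal_deriv (hmem u hu),
    fun u hu ↦ h.transversal_killing (hmem u hu)⟩

end KillingField

/-! ### The limit metric, local homogeneity and homogeneity. -/

section PenroseLimit

variable {m : ℕ} {E : Type*} [NormedAddCommGroup E] [NormedSpace ℝ E]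
  {M : Type*} [TopologicalSpace M] [ChartedSpace E M] [IsManifold 𝓘(ℝ, E) ∞ M]
  {g : LorentzMetric E M} {γ : ℝ → M} {I J : Set ℝ} {φ : ℝ → M → M} {p : M} {s : ℝ → ℝ}

lemma fderiv_rescale (Ω : ℝ) (z : Coord m) :
    DifferentiableAt ℝ (rescale m Ω) z ∧ ∀ X, fderiv ℝ (rescale m Ω) z X = rescale m Ω X := by
  let T : Coord m →L[ℝ] Coord m := (ContinuousLinearMap.fst ℝ ℝ _).prod
    ((Ω ^ 2 • pv m).prod (Ω • py m))
  have hT : rescale m Ω = T := by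
    funext X
    simp [T, rescale]
  rw [hT]
  exact ⟨T.differentiableAt, fun X ↦ by rw [T.fderiv]⟩

lemma rescale_eq (Ω : ℝ) (X : Coord m) :
    rescale m Ω X = X.1 • eu m + (Ω ^ 2 * X.2.1) • ev m + Ω • ey m X.2.2 := by
  simp [rescale, eu, ev, ey_apply]

/-- The `du dv` and `dy dy` terms scale by `Ω²`, the `dy dv` terms by `Ω³` and `dv²` by `Ω⁴`; there
are no other terms. Coefficients converge to their values on the axis by continuity. -/
lemma AdaptedCoordinates.isPenroseLimit (A : AdaptedCoordinates m g γ I) :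
    IsPenroseLimit A (planeForm (transversal A.form)) := by
  intro z hz X Y
  have hU : axis m z.1 ∈ A.U := A.axis_mem _ hz
  have hr : Tendsto (fun Ω : ℝ ↦ rescale m Ω z) (𝓝[>] 0) (𝓝 (axis m z.1)) := by
    have hc : Continuous fun Ω : ℝ ↦ rescale m Ω z := by
      unfold rescale
      fun_prop
    have h0 : rescale m 0 z = axis m z.1 := by simp [rescale, axis]
    rw [← h0]
    exact (hc.tendsto 0).mono_left nhdsWithin_le_nhds
  have hG : ∀ V W, Tendsto (fun Ω : ℝ ↦ A.form (rescale m Ω z) V W) (𝓝[>] 0)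
      (𝓝 (A.form (axis m z.1) V W)) := fun V W ↦
    (((A.isAdaptedForm.contDiffAt hU).clm_apply contDiffAt_const).clm_apply
      contDiffAt_const).continuousAt.tendsto.comp hr
  have hΩ : Tendsto (fun Ω : ℝ ↦ Ω) (𝓝[>] 0) (𝓝 0) := tendsto_id.mono_left nhdsWithin_le_nhds
  have hlim := ((((hΩ.pow 2).mul_const (X.2.1 * Y.2.1)).mul (hG (ev m) (ev m))).add
    ((hΩ.mul (((hG (ev m) (ey m Y.2.2)).const_mul X.2.1).add
      ((hG (ey m X.2.2) (ev m)).const_mul Y.2.1))))).add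
    ((hG (ey m X.2.2) (ey m Y.2.2)).const_add ((X.1 * Y.2.1 + X.2.1 * Y.1) / 2))
  have hval : planeForm (transversal A.form) z X Y = (X.1 * Y.2.1 + X.2.1 * Y.1) / 2
      + A.form (axis m z.1) (ey m X.2.2) (ey m Y.2.2) := rfl
  rw [hval]
  refine (hlim.congr' ?_).trans (by simp)
  filter_upwards [self_mem_nhdsWithin, hr.eventually (A.isOpen_U.mem_nhds hU)] with Ω hpos hmem
  have hne : Ω ≠ 0 := (ne_of_gt hpos)
  have heu := fun Y ↦ A.isAdaptedForm.apply_eu _ hmem Y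
  have heu' := fun Y ↦ A.isAdaptedForm.apply_eu' hmem Y
  have h1 : pullback g (A.Φ ∘ rescale m Ω) z X Y
      = A.form (rescale m Ω z) (rescale m Ω X) (rescale m Ω Y) := by
    rw [pullback_comp g ((A.localDiffeo.contMDiffAt hmem).mdifferentiableAt (by simp))
      (fderiv_rescale Ω z).1, (fderiv_rescale Ω z).2, (fderiv_rescale Ω z).2]
    rfl
  have e1 : (eu m).2.1 = 0 := rfl
  have e2 : (ev m).2.1 = 1 := rfl
  have e3 : ∀ y, (ey m y).2.1 = 0 := fun _ ↦ rfl
  rw [h1, rescale_eq Ω X, rescale_eq Ω Y]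
  simp only [map_add, map_smul, add_apply, smul_apply, heu, heu', e1, e2, e3, smul_eq_mul]
  field_simp
  ring

lemma AdaptedCoordinates.isPlaneWave (A : AdaptedCoordinates m g γ I) :
    IsPlaneWave I (fun u ↦ A.C (u, 0, 0)) (planeForm (transversal A.form)) where
  contDiffOn i j := by
    have h : ContDiffOn ℝ ∞ (fun u ↦ transversal A.form u (Pi.single i 1) (Pi.single j 1)) I :=
      fun u hu ↦ (((A.isAdaptedForm.contDiffAt_transversal (A.axis_mem u hu)).clm_apply
        contDiffAt_const).clm_apply contDiffAt_const).contDiffWithinAt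
    refine h.congr fun u hu ↦ ?_
    rw [A.transversal_form hu]
    simp [Pi.single_apply]
  posDef u hu := A.posDef _ (A.axis_mem u hu)
  metric z hz X Y := by
    rw [planeForm, A.transversal_form hz]

/-- A continuous local right inverse of a function with non-zero derivative. -/
lemma exists_local_inverse {s : ℝ → ℝ} {u : ℝ} (hs : ContDiffAt ℝ ∞ s u) (hu : deriv s u ≠ 0)
    {I : Set ℝ} (hI : IsOpen I) (huI : u ∈ I) :
    ∃ (σ : ℝ → ℝ) (T : Set ℝ), IsOpen T ∧ s u ∈ T ∧ ContinuousOn σ T ∧ σ (s u) = u ∧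
      ∀ w ∈ T, σ w ∈ I ∧ s (σ w) = w := by
  have hd : HasFDerivAt s
      ((ContinuousLinearEquiv.unitsEquivAut ℝ (Units.mk0 _ hu) : ℝ ≃L[ℝ] ℝ) : ℝ →L[ℝ] ℝ) u := by
    have h1 := (hs.differentiableAt (by simp)).hasDerivAt.hasFDerivAt
    refine h1.congr_fderiv ?_
    ext
    simp
  set e := hs.toOpenPartialHomeomorph s hd (by simp) with he
  have hes : ∀ x, e x = s x := fun x ↦ rfl
  have hu' : u ∈ e.source := hs.mem_toOpenPartialHomeomorph_source hd (by simp)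
  refine ⟨e.symm, e.target ∩ e.symm ⁻¹' I, e.symm.isOpen_inter_preimage hI, ?_,
    e.continuousOn_symm.mono inter_subset_left, ?_, fun w hw ↦ ⟨hw.2, ?_⟩⟩
  · rw [← hes]
    refine ⟨e.map_source hu', ?_⟩
    rw [mem_preimage, e.left_inv hu']
    exact huI
  · rw [← hes, e.left_inv hu']
  · rw [← hes, e.right_inv hw.1]

lemma IsHomogeneousAlong.flow_eq (hom : IsHomogeneousAlong g γ J φ p s) {t u w : ℝ}
    (hu : u ∈ J) (hw : w ∈ J) (h : s w = s u + t) : φ t (γ u) = γ w := by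
  rw [hom.orbit u hu, hom.orbit w hw, ← hom.group.add, h, add_comm]

lemma locallyIsometricAt_of_planeForm (hom : IsHomogeneousAlong g γ J φ p s)
    (hγ : IsNullGeodesicOn g γ J) {I₁ I₂ : Set ℝ} (A₁ : AdaptedCoordinates m g γ I₁)
    (A₂ : AdaptedCoordinates m g γ I₂) (hI₁ : I₁ ⊆ J) (hI₂ : I₂ ⊆ J)
    {h₁ h₂ : Coord m → Coord m → Coord m → ℝ}
    (hh₁ : ∀ z ∈ slab m I₁, h₁ z = planeForm (transversal A₁.form) z)
    (hh₂ : ∀ z ∈ slab m I₂, h₂ z = planeForm (transversal A₂.form) z)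
    {z₁ z₂ : Coord m} (hz₁ : z₁ ∈ slab m I₁) (hz₂ : z₂ ∈ slab m I₂) :
    LocallyIsometricAt (slab m I₁) h₁ (slab m I₂) h₂ z₁ z₂ := by
  have hu₁ : z₁.1 ∈ I₁ := hz₁
  have hu₂ : z₂.1 ∈ I₂ := hz₂
  have hsm : ∀ u ∈ J, ContDiffAt ℝ ∞ s u := fun u hu ↦
    hom.contDiffOn.contDiffAt (hγ.isOpen.mem_nhds hu)
  obtain ⟨σ, T, hT, hsT, hσ, hσ0, hσT⟩ := exists_local_inverse (hsm _ (hI₂ hu₂))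
    (hom.deriv_ne_zero hγ (hI₂ hu₂)) A₂.isOpen_interval hu₂
  -- The flow time that carries `γ(z₁.1)` to `γ(z₂.1)`.
  set t := s z₂.1 - s z₁.1 with ht
  have hnear : ∀ᶠ u in 𝓝 z₁.1, u ∈ I₁ ∧ s u + t ∈ T := by
    refine (A₁.isOpen_interval.eventually_mem hu₁).and ?_
    have hc : ContinuousAt (fun u ↦ s u + t) z₁.1 :=
      (hsm _ (hI₁ hu₁)).continuousAt.add continuousAt_const
    refine hc.eventually (hT.mem_nhds ?_)
    simpa [ht] using hsT
  obtain ⟨ε, hε, hball⟩ := Metric.eventually_nhds_iff_ball.1 hnear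
  set O := Metric.ball z₁.1 ε
  have hcont : ContinuousOn (fun u ↦ σ (s u + t)) O := by
    refine hσ.comp (fun u hu ↦ ?_) fun u hu ↦ (hball u hu).2
    exact ((hsm u (hI₁ (hball u hu).1)).continuousAt.add continuousAt_const).continuousWithinAt
  obtain ⟨a, b, A, hab, hA⟩ := exists_planeTransport hom.group (t := t) A₁ A₂
    Metric.isOpen_ball (convex_ball z₁.1 ε).isPreconnected ⟨z₁.1, Metric.mem_ball_self hε⟩
    (fun u hu ↦ (hball u hu).1) (fun u hu ↦ (hσT _ (hball u hu).2).1) hcont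
    fun u hu ↦ hom.flow_eq (hI₁ (hball u hu).1) (hI₂ (hσT _ (hball u hu).2).1)
      (hσT _ (hball u hu).2).2
  have ha := hA.scale_ne_zero
  refine ⟨hA.toOpenPartialHomeomorph z₁.2 z₂.2,
    hA.isLocalIsometry z₁.2 z₂.2 (fun u hu ↦ (hball u hu).1) (fun w hw ↦ ?_) hh₁ hh₂,
    Metric.mem_ball_self hε, ?_⟩
  · have h1 := (hσT _ (hball _ hw).2).1
    have h2 := hab _ hw
    rw [h2] at h1
    simpa [ha] using h1
  · have h2 := hab _ (Metric.mem_ball_self hε)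
    have h3 : s z₁.1 + t = s z₂.1 := by rw [ht]; ring
    simp only [h3, hσ0] at h2
    change hA.toFun z₁.2 z₂.2 z₁ = z₂
    simp [PlaneTransport.toFun, ← h2]

lemma IsHomogeneousAlong.injOn (hom : IsHomogeneousAlong g γ J φ p s)
    (hγ : IsNullGeodesicOn g γ J) : InjOn s J := by
  have key : ∀ u ∈ J, ∀ w ∈ J, u < w → s u ≠ s w := by
    intro u hu w hw huw heq
    have hsub : Icc u w ⊆ J := hγ.ordConnected.out hu hw
    obtain ⟨c, hc, hc0⟩ := exists_deriv_eq_zero huw (hom.contDiffOn.continuousOn.mono hsub) heq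
    exact hom.deriv_ne_zero hγ (hsub (Ioo_subset_Icc_self hc)) hc0
  intro u hu w hw heq
  rcases lt_trichotomy u w with h | h | h
  · exact absurd heq (key u hu w hw h)
  · exact h
  · exact absurd heq.symm (key w hw u hu h)

/-- Since `s` maps `I` bijectively onto `ℝ`, the map `ρ = s⁻¹ ∘ (s + t)` is defined on all of `I`,
so the transport can be taken with `O = I`. -/
lemma isHomogeneous_of_image_eq_univ (hom : IsHomogeneousAlong g γ J φ p s)
    (hγ : IsNullGeodesicOn g γ J) (A₁ : AdaptedCoordinates m g γ I) (hI : I ⊆ J)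
    (hs : s '' I = univ) :
    IsHomogeneous (slab m I) (planeForm (transversal A₁.form)) := by
  intro z₁ hz₁ z₂ hz₂
  have hu₁ : z₁.1 ∈ I := hz₁
  have hu₂ : z₂.1 ∈ I := hz₂
  have hsm : ∀ u ∈ J, ContDiffAt ℝ ∞ s u := fun u hu ↦
    hom.contDiffOn.contDiffAt (hγ.isOpen.mem_nhds hu)
  have hinj := (hom.injOn hγ).mono hI
  have hex : ∀ w : ℝ, ∃ x ∈ I, s x = w := fun w ↦ by
    have : w ∈ s '' I := hs ▸ mem_univ w
    exact this
  choose r hrI hr using hex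
  set t := s z₂.1 - s z₁.1 with ht
  have hcont : ContinuousOn (fun u ↦ r (s u + t)) I := by
    intro u hu
    refine ContinuousAt.continuousWithinAt ?_
    have hcs : ContinuousAt (fun u ↦ s u + t) u :=
      (hsm _ (hI hu)).continuousAt.add continuousAt_const
    refine ContinuousAt.comp (g := r) (f := fun u ↦ s u + t) ?_ hcs
    have hv := hrI (s u + t)
    obtain ⟨σ, T, hT, hsT, hσ, -, hσT⟩ := exists_local_inverse (hsm _ (hI hv))
      (hom.deriv_ne_zero hγ (hI hv)) A₁.isOpen_interval hv
    rw [hr] at hsT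
    refine (hσ.continuousAt (hT.mem_nhds hsT)).congr ?_
    filter_upwards [hT.mem_nhds hsT] with w hw
    -- By injectivity of `s`, the chosen inverse `r` coincides with the continuous local inverse
    -- `σ`.
    exact hinj (hσT w hw).1 (hrI w) ((hσT w hw).2.trans (hr w).symm)
  obtain ⟨a, b, A, hab, hA⟩ := exists_planeTransport hom.group (t := t) A₁ A₁
    A₁.isOpen_interval A₁.ordConnected.isPreconnected ⟨_, hu₁⟩ subset_rfl
    (fun u _ ↦ hrI (s u + t)) hcont fun u hu ↦ hom.flow_eq (hI hu) (hI (hrI _)) (hr _)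
  have ha := hA.scale_ne_zero
  have htarget : ∀ w, a⁻¹ * (w - b) ∈ I → w ∈ I := fun w hw ↦ by
    have h1 := hrI (s (a⁻¹ * (w - b)) + t)
    have h2 := hab _ hw
    rw [h2] at h1
    simpa [ha] using h1
  refine ⟨hA.toOpenPartialHomeomorph z₁.2 z₂.2,
    hA.isLocalIsometry z₁.2 z₂.2 subset_rfl htarget (fun _ _ ↦ rfl) (fun _ _ ↦ rfl),
    rfl, ?_, ?_⟩
  · refine Subset.antisymm (fun w hw ↦ htarget _ hw) fun w hw ↦ ?_
    have hwI : w.1 ∈ I := hw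
    -- The preimage of `w.1` under `ρ` is `r (s w.1 - t)`, the shift by `-t`; this shows that the
    -- target is the whole slab.
    have h1 : r (s (r (s w.1 - t)) + t) = w.1 :=
      hinj (hrI _) hwI (by rw [hr, hr]; ring)
    have h2 := hab _ (hrI (s w.1 - t))
    simp only [h1] at h2
    change a⁻¹ * (w.1 - b) ∈ I
    rw [h2]
    simpa [ha] using hrI (s w.1 - t)
  · have h2 := hab _ hu₁
    have h3 : s z₁.1 + t = s z₂.1 := by rw [ht]; ring
    have h4 : r (s z₂.1) = z₂.1 := hinj (hrI _) hu₂ (hr _)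
    simp only [h3, h4] at h2
    change hA.toFun z₁.2 z₂.2 z₁ = z₂
    simp [PlaneTransport.toFun, ← h2]

end PenroseLimit

end PenroseLimit

end

theorem mainTheorem1 {m : ℕ} {E : Type*} [NormedAddCommGroup E] [NormedSpace ℝ E]
    [FiniteDimensional ℝ E] (hdim : Module.finrank ℝ E = m + 2)
    {M : Type*} [TopologicalSpace M] [ChartedSpace E M] [IsManifold 𝓘(ℝ, E) ∞ M]
    (g : PenroseLimit.LorentzMetric E M) (γ : ℝ → M) (J : Set ℝ)
    (hγ : PenroseLimit.IsNullGeodesicOn g γ J)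
    (φ : ℝ → M → M) (p : M) (s : ℝ → ℝ)
    (hom : PenroseLimit.IsHomogeneousAlong g γ J φ p s) :
    (∀ (I : Set ℝ) (A : PenroseLimit.AdaptedCoordinates m g γ I), I ⊆ J →
      ∃ h : PenroseLimit.Coord m → PenroseLimit.Coord m → PenroseLimit.Coord m → ℝ,
        PenroseLimit.IsPenroseLimit A h ∧
        PenroseLimit.IsPlaneWave I (fun u ↦ A.C (u, 0, 0)) h ∧
        PenroseLimit.IsLocallyHomogeneous (PenroseLimit.slab m I) h ∧
        (∃ K : PenroseLimit.Coord m → PenroseLimit.Coord m,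
          PenroseLimit.IsKilling (PenroseLimit.slab m I) h K ∧
          ∀ u ∈ I, ∃ f : ℝ, f ≠ 0 ∧ K (u, 0, 0) = (f, 0, 0)) ∧
        (∀ z ∈ PenroseLimit.slab m I, ∀ X : PenroseLimit.Coord m,
          ∃ K : PenroseLimit.Coord m → PenroseLimit.Coord m,
            PenroseLimit.IsKilling (PenroseLimit.slab m I) h K ∧ K z = X) ∧
        (s '' I = Set.univ → PenroseLimit.IsHomogeneous (PenroseLimit.slab m I) h)) ∧
    (∀ (I₁ I₂ : Set ℝ) (A₁ : PenroseLimit.AdaptedCoordinates m g γ I₁)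
      (A₂ : PenroseLimit.AdaptedCoordinates m g γ I₂), I₁ ⊆ J → I₂ ⊆ J →
      ∀ h₁ h₂ : PenroseLimit.Coord m → PenroseLimit.Coord m → PenroseLimit.Coord m → ℝ,
        PenroseLimit.IsPenroseLimit A₁ h₁ → PenroseLimit.IsPenroseLimit A₂ h₂ →
        ∀ z₁ ∈ PenroseLimit.slab m I₁, ∀ z₂ ∈ PenroseLimit.slab m I₂,
          PenroseLimit.LocallyIsometricAt (PenroseLimit.slab m I₁) h₁
            (PenroseLimit.slab m I₂) h₂ z₁ z₂) := by
  refine ⟨fun I A hI ↦ ⟨PenroseLimit.planeForm (PenroseLimit.transversal A.form),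
    A.isPenroseLimit, A.isPlaneWave, fun z₁ hz₁ z₂ hz₂ ↦
      PenroseLimit.locallyIsometricAt_of_planeForm hom hγ A A hI hI (fun _ _ ↦ rfl)
        (fun _ _ ↦ rfl) hz₁ hz₂, ?_, fun z hz X ↦ ?_,
      PenroseLimit.isHomogeneous_of_image_eq_univ hom hγ A hI⟩,
    fun I₁ I₂ A₁ A₂ hI₁ hI₂ h₁ h₂ hl₁ hl₂ z₁ hz₁ z₂ hz₂ ↦
      PenroseLimit.locallyIsometricAt_of_planeForm hom hγ A₁ A₂ hI₁ hI₂ (fun z hz ↦ ?_)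
        (fun z hz ↦ ?_) hz₁ hz₂⟩
  · have hK := A.planeKilling hom hγ hI
    refine ⟨_, hK.isKilling 1 0, fun u hu ↦
      ⟨(deriv s u)⁻¹, inv_ne_zero (hom.deriv_ne_zero hγ (hI hu)), ?_⟩⟩
    simp [PenroseLimit.PlaneKilling.field]
  · have hK := A.planeKilling hom hγ hI
    have hs := hom.deriv_ne_zero hγ (hI hz)
    -- The field has `u`-component `1 / s'`, so the factor `X.1 * s'` matches `X.1`; a translation
    -- corrects the other components.
    refine ⟨_, hK.isKilling (X.1 * deriv s z.1) (X.2 - (X.1 * deriv s z.1) • (hK.field z).2), ?_⟩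
    refine Prod.ext ?_ ?_
    · simp [PenroseLimit.PlaneKilling.field, hs]
    · simp
  -- A Penrose limit is unique on the slab, so an arbitrary one is the plane wave there.
  · funext X Y
    exact tendsto_nhds_unique (hl₁ z hz X Y) (A₁.isPenroseLimit z hz X Y)
  · funext X Y
    exact tendsto_nhds_unique (hl₂ z hz X Y) (A₂.isPenroseLimit z hz X Y)
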